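/- Let $M\subset\mathbb{R}^n$ be a compact smooth embedded $d$-dimensional submanifold without boundary, with the Riemannian metric induced by $\mathbb{R}^n$ and Riemannian volume $d\mathrm{Vol}$. Let $q:M\to[0,\infty)$ be a smooth sampling density, and let $x\in M$ with $q(x)>0$. For a linear subspace $V\subseteq\mathbb{R}^n$ let $\Lambda^kV$ denote the space of antisymmetric arrays $A:\{1,\dots,n\}^k\to\mathbb{R}$ lying in $V\otimes\cdots\otimes V$ ($k$ factors), with the Frobenius inner product $\langle A,B\rangle=\sum_i A(i)B(i)$; such an array is identified with the alternating form $(v_1,\dots,v_k)\mapsto\langle A,v_1\otimes\cdots\otimes v_k\rangle$ on $V$. For $v\in\mathbb{R}^n$ and a $k$-array $A$ put $$v\wedge A=\frac1{k!}\sum_{\sigma\in S_{k+1}}\operatorname{sgn}(\sigma)\,(v\otimes A)^\sigma,\qquad f^\sigma(i_1,\dots,i_{k+1})=f(i_{\sigma(1)},\dots,i_{\sigma(k+1)}).$$ Let $W$ be a $k$-differential array on $M$, i.e. a smooth map assigning to each $y\in M$ an element $W(y)\in\Lambda^kT_yM$ (equivalently, a differential $k$-form on $M$), and let $\mathbf d_kW(x)\in\Lambda^{k+1}T_xM$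 be the array of the exterior derivative of this form at $x$. For $t>0$ set $$d_t(x)=\int_M e^{-\|y-x\|^2/(2t^2)}q(y)\,d\mathrm{Vol}(y),\qquad K_t(x,y)=(y-x)\,\frac{e^{-\|y-x\|^2/(2t^2)}}{d_t(x)},$$ $$\mathbf P_tW(x)=\int_M K_t(x,y)\wedge\bigl(W(y)-W(x)\bigr)\,q(y)\,d\mathrm{Vol}(y),$$ and let $\mathcal P$ be the orthogonal projection onto $\Lambda^{k+1}T_xM$. Then for every $\delta$ with $\frac12<\delta<1-\frac{d}{2(d+2)}$, $$\mathcal P\bigl(\mathbf P_tW(x)\bigr)=t^2\,\mathbf d_kW(x)+O\bigl(t^{2+f}\bigr)\quad(t\to0^+),\qquad f=\min\{4\delta-2,\;2(1-\delta)(d+2)\}.$$ In particular, $$\lim_{t\to0^+}\frac1{t^2}\,\mathcal P\bigl(\mathbf P_tW(x)\bigr)=\mathbf d_kW(x).$$ -/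

import Mathlib

open Set Filter Topology MeasureTheory Asymptotics
open scoped ContDiff

/-! ### Multidimensional arrays and alternating arrays -/

/-- `k`-dimensional real arrays of size `(n, …, n)`, that is, functions `I_n × ⋯ × I_n → ℝ`; the
inner product of `EuclideanSpace` is the Frobenius inner product. -/
abbrev KArray (n k : ℕ) : Type := EuclideanSpace ℝ (Fin k → Fin n)

/-- The tensor product `v₁ ⊗ ⋯ ⊗ v_k` of vectors of `ℝⁿ`, as an array. -/
noncomputable def pureTensor {n k : ℕ} (v : Fin k → EuclideanSpace ℝ (Fin n)) : KArray n k :=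
  WithLp.toLp 2 fun i => ∏ j, v j (i j)

/-- The subspace `V ⊗ ⋯ ⊗ V` (`k` factors) of the space of arrays. -/
def tensorPower {n : ℕ} (V : Submodule ℝ (EuclideanSpace ℝ (Fin n))) (k : ℕ) :
    Submodule ℝ (KArray n k) :=
  Submodule.span ℝ {A | ∃ v : Fin k → EuclideanSpace ℝ (Fin n), (∀ j, v j ∈ V) ∧ A = pureTensor v}

/-- The arrays of `ℝⁿ` that change by the sign of the permutation when the indices are permuted. -/
def antisymmetricArrays (n k : ℕ) : Submodule ℝ (KArray n k) where
  carrier := {A | ∀ (σ : Equiv.Perm (Fin k)) (i : Fin k → Fin n),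
    A (fun j => i (σ j)) = ((Equiv.Perm.sign σ : ℤ) : ℝ) * A i}
  add_mem' := by
    intro A B hA hB σ i
    simp only [PiLp.add_apply, hA σ i, hB σ i]
    ring
  zero_mem' := by
    intro σ i
    simp
  smul_mem' := by
    intro c A hA σ i
    simp only [PiLp.smul_apply, smul_eq_mul, hA σ i]
    ring

/-- The space of `k`-alternating arrays in the subspace `V` of `ℝⁿ`; this is the copy of the
`k`-th exterior power of `V` inside the space of arrays. -/
def alternatingArrays {n : ℕ} (V : Submodule ℝ (EuclideanSpace ℝ (Fin n))) (k : ℕ) :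
    Submodule ℝ (KArray n k) :=
  tensorPower V k ⊓ antisymmetricArrays n k

/-- The wedge product of a `1`-array (a vector of `ℝⁿ`) and a `k`-array,
`(1 / (1! k!)) ∑_σ sgn(σ) (v ⊗ A)^σ`. -/
noncomputable def vecWedge {n k : ℕ} (v : EuclideanSpace ℝ (Fin n)) (A : KArray n k) :
    KArray n (k + 1) :=
  WithLp.toLp 2 fun i => (1 / (Nat.factorial k : ℝ)) *
    ∑ σ : Equiv.Perm (Fin (k + 1)),
      ((Equiv.Perm.sign σ : ℤ) : ℝ) * (v (i (σ 0)) * A (fun j => i (σ j.succ)))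

/-- The multilinear form `(v₁, …, v_k) ↦ ⟨A, v₁ ⊗ ⋯ ⊗ v_k⟩`. -/
noncomputable def arrayMultilinear {n k : ℕ} (A : KArray n k) :
    ContinuousMultilinearMap ℝ (fun _ : Fin k => EuclideanSpace ℝ (Fin n)) ℝ :=
  ∑ i : Fin k → Fin n, A i •
    (ContinuousMultilinearMap.mkPiAlgebra ℝ (Fin k) ℝ).compContinuousLinearMap
      (fun j => (EuclideanSpace.proj (i j) : EuclideanSpace ℝ (Fin n) →L[ℝ] ℝ))

theorem arrayMultilinear_apply {n k : ℕ} (A : KArray n k)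
    (v : Fin k → EuclideanSpace ℝ (Fin n)) :
    arrayMultilinear A v = inner ℝ A (pureTensor v) := by
  simp [arrayMultilinear, pureTensor, PiLp.inner_apply,
    mul_comm]

/-- The alternating form of an alternating array. The averaging over permutations only serves to
make the form alternating for every array `A`; when `A` is alternating, the value is
`⟨A, v₁ ⊗ ⋯ ⊗ v_k⟩`, see `arrayForm_apply`. -/
noncomputable def arrayForm {n k : ℕ} (A : KArray n k) :
    EuclideanSpace ℝ (Fin n) [⋀^Fin k]→L[ℝ] ℝ :=
  (1 / (Nat.factorial k : ℝ)) • (arrayMultilinear A).alternatization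

theorem arrayForm_apply {n k : ℕ} (A : KArray n k) (hA : A ∈ antisymmetricArrays n k)
    (v : Fin k → EuclideanSpace ℝ (Fin n)) :
    arrayForm A v = inner ℝ A (pureTensor v) := by
  have key : ∀ σ : Equiv.Perm (Fin k), Equiv.Perm.sign σ • arrayMultilinear A (v ∘ σ)
      = inner ℝ A (pureTensor v) := by
    intro σ
    rw [arrayMultilinear_apply]
    have h1 : inner ℝ A (pureTensor (v ∘ σ))
        = ((Equiv.Perm.sign σ : ℤ) : ℝ) * inner ℝ A (pureTensor v) := by
      simp only [PiLp.inner_apply, pureTensor, Function.comp_apply, Finset.mul_sum]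
      refine Fintype.sum_equiv (Equiv.arrowCongr σ (Equiv.refl (Fin n))) _ _ fun i => ?_
      have h2 := hA σ.symm i
      have h3 : (Equiv.arrowCongr σ (Equiv.refl (Fin n))) i = fun j => i (σ.symm j) := rfl
      have h4 : ∏ j, v (σ j) (i j) = ∏ j, v j (i (σ.symm j)) :=
        Fintype.prod_equiv σ _ _ fun j => by simp
      have h5 : ((Equiv.Perm.sign σ : ℤ) : ℝ) * ((Equiv.Perm.sign σ : ℤ) : ℝ) = 1 := by
        rw [← Int.cast_mul, Int.units_coe_mul_self, Int.cast_one]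
      rw [h3, h4]
      simp only [h2, Equiv.Perm.sign_symm]
      simp only [RCLike.inner_apply, conj_trivial]
      linear_combination (-(A i * ∏ j, v j (i (σ.symm j)))) * h5
    rw [h1, Units.smul_def, zsmul_eq_mul, ← mul_assoc, ← Int.cast_mul, Int.units_coe_mul_self,
      Int.cast_one, one_mul]
  have hk : (Nat.factorial k : ℝ) ≠ 0 := by exact_mod_cast Nat.factorial_ne_zero k
  have h6 : arrayForm A v = (1 / (Nat.factorial k : ℝ)) *
      ((arrayMultilinear A).alternatization v) := rfl
  rw [h6, ContinuousMultilinearMap.alternatization_apply_apply, Finset.sum_congr rfl fun σ _ => key σ]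
  simp [Fintype.card_perm]
  field_simp

/-! ### Submanifolds of `ℝⁿ` -/

/-- `φ : V → M` is a smooth local parametrization (the inverse of a coordinate system) of the
`d`-dimensional submanifold `M`: `V` is open in `ℝᵈ`, `φ` is an injective smooth immersion, and
`φ` maps open subsets of `V` to relatively open subsets of `M`. -/
structure IsLocalParam {n d : ℕ} (M : Set (EuclideanSpace ℝ (Fin n)))
    (V : Set (EuclideanSpace ℝ (Fin d)))
    (φ : EuclideanSpace ℝ (Fin d) → EuclideanSpace ℝ (Fin n)) : Prop where
  isOpen : IsOpen V
  smooth : ContDiffOn ℝ ∞ φ V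
  injOn : InjOn φ V
  immersion : ∀ u ∈ V, Function.Injective (fderiv ℝ φ u)
  isOpen_image : ∀ O : Set (EuclideanSpace ℝ (Fin d)), O ⊆ V → IsOpen O →
    ∃ U : Set (EuclideanSpace ℝ (Fin n)), IsOpen U ∧ φ '' O = U ∩ M

/-- `M` is an embedded smooth `d`-dimensional submanifold (without boundary) of `ℝⁿ`. -/
def IsSubmanifold {n : ℕ} (d : ℕ) (M : Set (EuclideanSpace ℝ (Fin n))) : Prop :=
  ∀ x ∈ M, ∃ (V : Set (EuclideanSpace ℝ (Fin d)))
    (φ : EuclideanSpace ℝ (Fin d) → EuclideanSpace ℝ (Fin n)), IsLocalParam M V φ ∧ x ∈ φ '' V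

/-- Smoothness of a function on the `d`-dimensional submanifold `M`, in all local coordinates. -/
def SmoothOnSubmanifold {n : ℕ} (d : ℕ) (M : Set (EuclideanSpace ℝ (Fin n))) {F : Type*}
    [NormedAddCommGroup F] [NormedSpace ℝ F] (f : EuclideanSpace ℝ (Fin n) → F) : Prop :=
  ∀ (V : Set (EuclideanSpace ℝ (Fin d)))
    (φ : EuclideanSpace ℝ (Fin d) → EuclideanSpace ℝ (Fin n)), IsLocalParam M V φ →
    ContDiffOn ℝ ∞ (fun u => f (φ u)) V

/-- The tangent space `T_x M ⊆ ℝⁿ`, spanned by the velocities of smooth curves in `M`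
through `x`. -/
def embTangentSpace {n : ℕ} (M : Set (EuclideanSpace ℝ (Fin n)))
    (x : EuclideanSpace ℝ (Fin n)) : Submodule ℝ (EuclideanSpace ℝ (Fin n)) :=
  Submodule.span ℝ {w | ∃ γ : ℝ → EuclideanSpace ℝ (Fin n), ContDiffAt ℝ ∞ γ 0 ∧ γ 0 = x ∧
    (∀ᶠ s in 𝓝 0, γ s ∈ M) ∧ deriv γ 0 = w}

/-- The Riemannian volume of the `d`-dimensional submanifold `M` with the metric induced by `ℝⁿ`:
the `d`-dimensional Hausdorff measure on `M`, normalized to agree with Lebesgue measure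
on `ℝᵈ`. -/
noncomputable def riemVolume {n : ℕ} (d : ℕ) (M : Set (EuclideanSpace ℝ (Fin n))) :
    Measure (EuclideanSpace ℝ (Fin n)) :=
  (Measure.euclideanHausdorffMeasure d).restrict M

/-! ### Differential arrays and the exterior derivative -/

/-- `W` is a `k`-differential array on `M`: a smooth section with `W x` a `k`-alternating array
in `T_x M`. Values of `W` outside `M` play no role. -/
structure IsDifferentialArray {n : ℕ} (d : ℕ) (M : Set (EuclideanSpace ℝ (Fin n))) {k : ℕ}
    (W : EuclideanSpace ℝ (Fin n) → KArray n k) : Prop where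
  mem : ∀ y ∈ M, W y ∈ alternatingArrays (embTangentSpace M y) k
  smooth : SmoothOnSubmanifold d M W

/-- The differential form of `W` written in the local coordinates given by `φ`. -/
noncomputable def coordForm {n d k : ℕ}
    (φ : EuclideanSpace ℝ (Fin d) → EuclideanSpace ℝ (Fin n))
    (W : EuclideanSpace ℝ (Fin n) → KArray n k) (u : EuclideanSpace ℝ (Fin d)) :
    EuclideanSpace ℝ (Fin d) [⋀^Fin k]→L[ℝ] ℝ :=
  (arrayForm (W (φ u))).compContinuousLinearMap (fderiv ℝ φ u)

/-- `B` is the value at `x` of the exterior derivative of the `k`-differential array `W`: `B` is a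
`(k+1)`-alternating array in `T_x M` and in all local coordinates its form is the exterior
derivative of the form of `W`. -/
def IsExteriorDerivAt {n : ℕ} (d : ℕ) (M : Set (EuclideanSpace ℝ (Fin n))) {k : ℕ}
    (W : EuclideanSpace ℝ (Fin n) → KArray n k) (x : EuclideanSpace ℝ (Fin n))
    (B : KArray n (k + 1)) : Prop :=
  B ∈ alternatingArrays (embTangentSpace M x) (k + 1) ∧
  ∀ (V : Set (EuclideanSpace ℝ (Fin d)))
    (φ : EuclideanSpace ℝ (Fin d) → EuclideanSpace ℝ (Fin n)), IsLocalParam M V φ →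
    ∀ u ∈ V, φ u = x →
      (arrayForm B).compContinuousLinearMap (fderiv ℝ φ u) = extDeriv (coordForm φ W) u

open Classical in
/-- The exterior derivative `d_k W (x)` of a `k`-differential array. -/
noncomputable def exteriorDeriv {n : ℕ} (d : ℕ) (M : Set (EuclideanSpace ℝ (Fin n))) {k : ℕ}
    (W : EuclideanSpace ℝ (Fin n) → KArray n k) (x : EuclideanSpace ℝ (Fin n)) :
    KArray n (k + 1) :=
  if h : ∃ B, IsExteriorDerivAt d M W x B then h.choose else 0

/-! ### The operator `P_t` -/

/-- The normalization `d_t(x) = ∫_M exp(-‖y - x‖² / (2 t²)) q(y) dVol(y)`. -/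
noncomputable def kernelNormalization {n : ℕ} (d : ℕ) (M : Set (EuclideanSpace ℝ (Fin n)))
    (q : EuclideanSpace ℝ (Fin n) → ℝ) (t : ℝ) (x : EuclideanSpace ℝ (Fin n)) : ℝ :=
  ∫ y, Real.exp (-‖y - x‖ ^ 2 / (2 * t ^ 2)) * q y ∂(riemVolume d M)

/-- The vector-valued kernel `K_t(x, y) = (y - x) exp(-‖y - x‖² / (2 t²)) / d_t(x)`. -/
noncomputable def gaussKernel {n : ℕ} (d : ℕ) (M : Set (EuclideanSpace ℝ (Fin n)))
    (q : EuclideanSpace ℝ (Fin n) → ℝ) (t : ℝ) (x y : EuclideanSpace ℝ (Fin n)) :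
    EuclideanSpace ℝ (Fin n) :=
  (Real.exp (-‖y - x‖ ^ 2 / (2 * t ^ 2)) / kernelNormalization d M q t x) • (y - x)

/-- The operator `P_t W (x) = ∫_M K_t(x, y) ∧ (W(y) - W(x)) q(y) dVol(y)`. -/
noncomputable def diffusionOp {n : ℕ} (d : ℕ) (M : Set (EuclideanSpace ℝ (Fin n)))
    (q : EuclideanSpace ℝ (Fin n) → ℝ) {k : ℕ} (t : ℝ)
    (W : EuclideanSpace ℝ (Fin n) → KArray n k) (x : EuclideanSpace ℝ (Fin n)) :
    KArray n (k + 1) :=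
  ∫ y, q y • vecWedge (gaussKernel d M q t x y) (W y - W x) ∂(riemVolume d M)

/-- The orthogonal projection of `P_t W (x)`, for the Frobenius inner product, onto the
`(k+1)`-alternating arrays in `T_x M`. -/
noncomputable def projDiffusionOp {n : ℕ} (d : ℕ) (M : Set (EuclideanSpace ℝ (Fin n)))
    (q : EuclideanSpace ℝ (Fin n) → ℝ) {k : ℕ} (t : ℝ)
    (W : EuclideanSpace ℝ (Fin n) → KArray n k) (x : EuclideanSpace ℝ (Fin n)) :
    KArray n (k + 1) :=
  (alternatingArrays (embTangentSpace M x) (k + 1)).starProjection (diffusionOp d M q t W x)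

/-! ### Even and odd parts of smooth functions -/

section Parity

/-! Near `x`, write `M` as the graph `ψ` of a map over a ball of the tangent space, identified with
`ℝᵈ` by an isometry `ι`. Since `ψ` has derivative `ι` at `0`, Pythagoras gives `‖ψ s - x‖² = ‖s‖² +
O(‖s‖⁴)`, and the volume density in this chart is `1 + O(‖s‖²)`. Under a Gaussian of width `t` each
of these perturbations costs a relative factor `t²`, and the part of `M` outside the chart
contributes less than any power of `t`. So a Gaussian integral over `M` becomes one over `ℝᵈ`, where
the symmetry `s ↦ -s` leaves only the even part of the integrand
(`IsGraphChart.integral_gaussian_sub_isBigO`).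

Let `b` be the wedge product followed by the projection. In `q(y) b(y - x, W y - W x)` both
arguments vanish at `x`, and the cubic Taylor term is odd, so the even part is the quadratic form
`q(x) b(ι s, dW s)` up to fourth order. Gaussian second moments turn this form into its trace: the
numerator is `κ t^(d+2) D + O(t^(d+4))` with `D = ∑ b(ι eᵢ, ∂ᵢW)`. The normalization is `κ t^d +
O(t^(d+2))` with `κ > 0` because `q(x) > 0`. The quotient is `t² D + O(t⁴)`, which is stronger than
the stated error, since `f ≤ 4δ - 2 < 2`.

Finally `D` is the exterior derivative: paired with tangent vectors it is the alternating sum of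
derivatives of `W`, and naturality of `extDeriv` under pullback carries this to every local
parametrization (`IsGraphChart.isExteriorDerivAt`). -/

theorem tendsto_neg_nhds_zero {E : Type*} [NormedAddCommGroup E] :
    Tendsto (fun s : E => -s) (𝓝 0) (𝓝 0) := by
  simpa using (continuous_neg.tendsto (0 : E))

variable {E F G H : Type*} [NormedAddCommGroup E] [NormedSpace ℝ E]
  [NormedAddCommGroup F] [NormedSpace ℝ F] [NormedAddCommGroup G] [NormedSpace ℝ G]
  [NormedAddCommGroup H] [NormedSpace ℝ H]

/-- The mean value inequality on the closed ball of radius `‖s‖` raises the order of vanishing by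
one. It stands in for Taylor's formula in the two lemmas on even and odd parts. -/
theorem isBigO_norm_pow_succ_of_fderiv {f : E → F} {m : ℕ}
    (hd : ∀ᶠ s in 𝓝 (0 : E), DifferentiableAt ℝ f s) (h0 : f 0 = 0)
    (h : fderiv ℝ f =O[𝓝 0] fun s => ‖s‖ ^ m) : f =O[𝓝 0] fun s => ‖s‖ ^ (m + 1) := by
  obtain ⟨C, hC0, hC⟩ := h.exists_nonneg
  rw [IsBigOWith] at hC
  obtain ⟨ε, hε, hball⟩ := Metric.eventually_nhds_iff_ball.1 (hd.and hC)
  refine IsBigO.of_bound C ?_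
  filter_upwards [Metric.ball_mem_nhds (0 : E) hε] with s hs
  have hsub : ∀ z ∈ Metric.closedBall (0 : E) ‖s‖, z ∈ Metric.ball (0 : E) ε := by
    intro z hz
    simp only [Metric.mem_closedBall, Metric.mem_ball, dist_zero_right] at *
    linarith
  have := (convex_closedBall (0 : E) ‖s‖).norm_image_sub_le_of_norm_fderiv_le (𝕜 := ℝ) (f := f)
    (C := C * ‖s‖ ^ m) (x := 0) (y := s) (fun z hz => (hball z (hsub z hz)).1)
    (fun z hz => by
      have h1 := (hball z (hsub z hz)).2
      have h2 : ‖z‖ ≤ ‖s‖ := by simpa using hz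
      simp only [norm_pow, norm_norm] at h1
      exact h1.trans (by gcongr)) (by simp) (by simp)
  simp only [h0, sub_zero] at this
  simpa [pow_succ, mul_assoc] using this

theorem ContDiffAt.comp_neg_zero {f : E → F} {m : WithTop ℕ∞} (hf : ContDiffAt ℝ m f 0) :
    ContDiffAt ℝ m (fun s => f (-s)) 0 := by
  have : ContDiffAt ℝ m f (-(0 : E)) := by simpa using hf
  exact this.comp (0 : E) contDiffAt_id.neg

theorem ContDiffAt.isBigO_sub_zero {f : E → F} (hf : ContDiffAt ℝ 1 f 0) :
    (fun s => f s - f 0) =O[𝓝 0] fun s => ‖s‖ := by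
  have := (hf.differentiableAt (by simp)).isBigO_sub
  simpa using this.trans (isBigO_refl _ _).norm_right

theorem ContDiffAt.isBigO_sub_neg {f : E → F} (hf : ContDiffAt ℝ 3 f 0) :
    (fun s => f s - f (-s)) =O[𝓝 0] fun s => ‖s‖ := by
  have l13 : (1 : WithTop ℕ∞) ≤ 3 := by norm_num
  have := (hf.of_le l13).isBigO_sub_zero.sub (hf.of_le l13).comp_neg_zero.isBigO_sub_zero
  simpa using this

theorem ContDiffAt.isBigO_even_part {f : E → F} (hf : ContDiffAt ℝ 2 f 0) :
    (fun s => f s + f (-s) - (2 : ℝ) • f 0) =O[𝓝 0] fun s => ‖s‖ ^ 2 := by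
  have hd : ∀ᶠ s in 𝓝 (0 : E), DifferentiableAt ℝ f s :=
    (hf.eventually (by simp)).mono fun s hs => hs.differentiableAt (by simp)
  have hd' : ∀ᶠ s in 𝓝 (0 : E), DifferentiableAt ℝ f (-s) := tendsto_neg_nhds_zero.eventually hd
  have hder : ∀ᶠ s in 𝓝 (0 : E), HasFDerivAt (fun s => f s + f (-s) - (2 : ℝ) • f 0)
      (fderiv ℝ f s - fderiv ℝ f (-s)) s := by
    filter_upwards [hd, hd'] with s h1 h2
    have h3 : HasFDerivAt (fun s => f (-s)) (-(fderiv ℝ f (-s))) s := by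
      have := h2.hasFDerivAt.comp s (hasFDerivAt_id s).neg
      refine this.congr_fderiv ?_
      ext; simp
    simpa [sub_eq_add_neg] using (h1.hasFDerivAt.add h3).sub_const ((2 : ℝ) • f 0)
  refine isBigO_norm_pow_succ_of_fderiv (hder.mono fun s hs => hs.differentiableAt)
    (by simp [two_smul]) ?_
  have h1 : ContDiffAt ℝ 1 (fderiv ℝ f) 0 := hf.fderiv_right (by norm_num)
  have h2 := h1.isBigO_sub_zero
  have h3 := h1.comp_neg_zero.isBigO_sub_zero
  refine ((h2.sub h3).congr' ?_ EventuallyEq.rfl).trans ?_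
  · filter_upwards [hder] with s hs
    rw [hs.fderiv]; simp
  · simpa using isBigO_refl _ _

/-- The derivative of the left side is the even part of `fderiv ℝ f` minus its value at `0`, which
is already known to be of second order; integrating gives third order. -/
theorem ContDiffAt.isBigO_odd_part {f : E → F} (hf : ContDiffAt ℝ 3 f 0) :
    (fun s => f s - f (-s) - (2 : ℝ) • fderiv ℝ f 0 s) =O[𝓝 0] fun s => ‖s‖ ^ 3 := by
  have hd : ∀ᶠ s in 𝓝 (0 : E), DifferentiableAt ℝ f s :=
    (hf.eventually (by simp)).mono fun s hs => hs.differentiableAt (by simp)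
  have hd' : ∀ᶠ s in 𝓝 (0 : E), DifferentiableAt ℝ f (-s) := tendsto_neg_nhds_zero.eventually hd
  have hder : ∀ᶠ s in 𝓝 (0 : E), HasFDerivAt (fun s => f s - f (-s) - (2 : ℝ) • fderiv ℝ f 0 s)
      (fderiv ℝ f s + fderiv ℝ f (-s) - (2 : ℝ) • fderiv ℝ f 0) s := by
    filter_upwards [hd, hd'] with s h1 h2
    have h3 : HasFDerivAt (fun s => f (-s)) (-(fderiv ℝ f (-s))) s := by
      have := h2.hasFDerivAt.comp s (hasFDerivAt_id s).neg
      refine this.congr_fderiv ?_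
      ext; simp
    have h4 := (h1.hasFDerivAt.sub h3).sub ((fderiv ℝ f 0).hasFDerivAt.const_smul (2 : ℝ) (x := s))
    rw [sub_neg_eq_add] at h4
    exact h4
  refine isBigO_norm_pow_succ_of_fderiv (hder.mono fun s hs => hs.differentiableAt)
    (by simp) ?_
  have h1 : ContDiffAt ℝ 2 (fderiv ℝ f) 0 := hf.fderiv_right (by norm_num)
  refine h1.isBigO_even_part.congr' ?_ EventuallyEq.rfl
  filter_upwards [hder] with s hs
  rw [hs.fderiv]

theorem ContinuousLinearMap.isBigO_bilin {ι : Type*} {l : Filter ι} (b : F →L[ℝ] G →L[ℝ] H)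
    {f : ι → F} {g : ι → G} {u v : ι → ℝ} (hf : f =O[l] u) (hg : g =O[l] v) :
    (fun s => b (f s) (g s)) =O[l] fun s => u s * v s := by
  have h : (fun s => b (f s) (g s)) =O[l] fun s => ‖f s‖ * ‖g s‖ := by
    refine IsBigO.of_bound ‖b‖ (Eventually.of_forall fun s => ?_)
    have := b.le_opNorm₂ (f s) (g s)
    simpa [mul_assoc] using this
  exact h.trans (hf.norm_left.mul hg.norm_left)

/-- The even part of `q • b (a, g)`, where `a` and `g` vanish at the origin, up to fourth order. -/
theorem isBigO_even_part_smul_bilin (b : F →L[ℝ] G →L[ℝ] H) {q : E → ℝ} {a : E → F} {g : E → G}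
    (hq : ContDiffAt ℝ 3 q 0) (ha : ContDiffAt ℝ 3 a 0) (hg : ContDiffAt ℝ 3 g 0)
    (ha0 : a 0 = 0) (hg0 : g 0 = 0) :
    (fun s => q s • b (a s) (g s) + q (-s) • b (a (-s)) (g (-s))
      - (2 : ℝ) • (q 0 • b (fderiv ℝ a 0 s) (fderiv ℝ g 0 s))) =O[𝓝 0] fun s => ‖s‖ ^ 4 := by
  have l12 : (2 : WithTop ℕ∞) ≤ 3 := by norm_num
  have ae : (fun s => a s + a (-s)) =O[𝓝 0] fun s => ‖s‖ ^ 2 := by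
    simpa [ha0] using (ha.of_le l12).isBigO_even_part
  have ge : (fun s => g s + g (-s)) =O[𝓝 0] fun s => ‖s‖ ^ 2 := by
    simpa [hg0] using (hg.of_le l12).isBigO_even_part
  have qe : (fun s => q s + q (-s) - 2 * q 0) =O[𝓝 0] fun s => ‖s‖ ^ 2 := by
    simpa using (hq.of_le l12).isBigO_even_part
  have qb : (fun s => q s + q (-s)) =O[𝓝 0] fun _ => (1 : ℝ) := by
    have h1 : ContinuousAt (fun s => q s + q (-s)) 0 :=
      hq.continuousAt.add hq.comp_neg_zero.continuousAt
    exact h1.isBigO_one ℝ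
  -- Write `X± = X(s) ± X(-s)`. The even part of the product is a quarter of the sum of the products
  -- of `q±, a±, g±` with an even number of minus signs. `T1` to `T3` are those containing `a₊` or
  -- `g₊`. In `q₊ b(a₋, g₋)`, `T4` replaces `q₊` by `2 q(0)`, and `T5`, `T6` replace `a₋` and `g₋`
  -- by twice the differentials.
  have T1 := qb.smul (b.isBigO_bilin ae ge)
  have T2 := hq.isBigO_sub_neg.smul (b.isBigO_bilin ae hg.isBigO_sub_neg)
  have T3 := hq.isBigO_sub_neg.smul (b.isBigO_bilin ha.isBigO_sub_neg ge)
  have T4 := qe.smul (b.isBigO_bilin ha.isBigO_sub_neg hg.isBigO_sub_neg)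
  have T5 := b.isBigO_bilin ha.isBigO_odd_part hg.isBigO_sub_neg
  have T6 := b.isBigO_bilin ((fderiv ℝ a 0).isBigO_id _).norm_right hg.isBigO_odd_part
  have S : ∀ {u : E → H} {v : E → ℝ}, u =O[𝓝 0] v → (∀ s, v s = ‖s‖ ^ 4) →
      u =O[𝓝 0] fun s => ‖s‖ ^ 4 := by
    intro u v h h'
    rwa [show v = fun s => ‖s‖ ^ 4 from funext h'] at h
  have R1 := S T1 (fun s => by simp; ring)
  have R2 := S T2 (fun s => by simp; ring)
  have R3 := S T3 (fun s => by simp; ring)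
  have R4 := S T4 (fun s => by simp; ring)
  have R5 := S T5 (fun s => by ring)
  have R6 := S T6 (fun s => by ring)
  have key := ((((R1.const_smul_left (1/4 : ℝ)).add (R2.const_smul_left (1/4 : ℝ))).add
    (R3.const_smul_left (1/4 : ℝ))).add (R4.const_smul_left (1/4 : ℝ))).add
    ((R5.const_smul_left (q 0 / 2)).add (R6.const_smul_left (q 0)))
  refine key.congr_left fun s => ?_
  simp only [Pi.smul_apply, map_sub, map_add, map_smul, sub_apply, add_apply,
    smul_apply]
  module

end Parity

/-! ### Gaussian moments -/

section Gaussian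

/-- Half of the Gaussian decay absorbs the power: `x ^ p ≤ p! eˣ`, and `x ≤ 1 + x²/4` because `(x/2
- 1)² ≥ 0`. -/
theorem pow_mul_exp_neg_sq_le {x : ℝ} (hx : 0 ≤ x) (p : ℕ) :
    x ^ p * Real.exp (-(1 / 2) * x ^ 2) ≤
      p.factorial * Real.exp 1 * Real.exp (-(1 / 4) * x ^ 2) := by
  have h1 : x ^ p ≤ p.factorial * Real.exp x := by
    have := Real.pow_div_factorial_le_exp x hx p
    rwa [div_le_iff₀ (by positivity), mul_comm] at this
  have h2 : Real.exp x ≤ Real.exp 1 * Real.exp (1 / 4 * x ^ 2) := by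
    rw [← Real.exp_add]
    exact Real.exp_le_exp.2 (by nlinarith [sq_nonneg (x / 2 - 1)])
  calc x ^ p * Real.exp (-(1 / 2) * x ^ 2)
      ≤ (p.factorial * (Real.exp 1 * Real.exp (1 / 4 * x ^ 2))) * Real.exp (-(1 / 2) * x ^ 2) := by
        gcongr; exact h1.trans (by gcongr)
    _ = p.factorial * Real.exp 1 * Real.exp (-(1 / 4) * x ^ 2) := by
        rw [mul_assoc, mul_assoc, mul_assoc, ← Real.exp_add]
        congr 4; ring

variable {d : ℕ}

theorem integrable_exp_neg_mul_norm_sq {b : ℝ} (hb : 0 < b) :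
    Integrable (fun s : EuclideanSpace ℝ (Fin d) => Real.exp (-b * ‖s‖ ^ 2)) := by
  have := (GaussianFourier.integrable_cexp_neg_mul_sq_norm_add (b := (b : ℂ))
    (V := EuclideanSpace ℝ (Fin d)) (by simpa using hb) 0 0).norm
  refine this.congr (Eventually.of_forall fun s => ?_)
  simp [Complex.norm_exp, ← Complex.ofReal_pow]

theorem integrable_norm_pow_mul_gaussian (p : ℕ) :
    Integrable (fun s : EuclideanSpace ℝ (Fin d) => ‖s‖ ^ p * Real.exp (-(1 / 2) * ‖s‖ ^ 2)) := by
  refine Integrable.mono' ((integrable_exp_neg_mul_norm_sq (b := 1 / 4) (by norm_num)).const_mul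
    (p.factorial * Real.exp 1)) (by fun_prop) (Eventually.of_forall fun s => ?_)
  rw [Real.norm_of_nonneg (by positivity)]
  exact pow_mul_exp_neg_sq_le (norm_nonneg s) p

theorem gaussian_smul_arg {t : ℝ} (ht : 0 < t) (z : EuclideanSpace ℝ (Fin d)) :
    Real.exp (-‖t • z‖ ^ 2 / (2 * t ^ 2)) = Real.exp (-(1 / 2) * ‖z‖ ^ 2) := by
  congr 1
  rw [norm_smul, Real.norm_of_nonneg ht.le]
  field_simp

theorem integral_eq_pow_smul_integral_comp_smul {G : Type*} [NormedAddCommGroup G]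
    [NormedSpace ℝ G] {t : ℝ} (ht : 0 < t) (f : EuclideanSpace ℝ (Fin d) → G) :
    ∫ s, f s = t ^ d • ∫ z, f (t • z) := by
  rw [Measure.integral_comp_smul, finrank_euclideanSpace_fin, abs_of_pos (by positivity), smul_smul,
    mul_inv_cancel₀ (by positivity), one_smul]

theorem integrable_norm_pow_mul_gaussian_scaled (p : ℕ) {t : ℝ} (ht : 0 < t) :
    Integrable (fun s : EuclideanSpace ℝ (Fin d) =>
      ‖s‖ ^ p * Real.exp (-‖s‖ ^ 2 / (2 * t ^ 2))) := by
  rw [← integrable_comp_smul_iff volume _ ht.ne']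
  simp_rw [gaussian_smul_arg ht, norm_smul, mul_pow, mul_assoc]
  exact (integrable_norm_pow_mul_gaussian p).const_mul _

theorem integral_norm_pow_mul_gaussian_scaled (p : ℕ) {t : ℝ} (ht : 0 < t) :
    ∫ s : EuclideanSpace ℝ (Fin d), ‖s‖ ^ p * Real.exp (-‖s‖ ^ 2 / (2 * t ^ 2)) =
      t ^ (d + p) * ∫ s : EuclideanSpace ℝ (Fin d), ‖s‖ ^ p * Real.exp (-(1 / 2) * ‖s‖ ^ 2) := by
  rw [integral_eq_pow_smul_integral_comp_smul ht]
  simp_rw [gaussian_smul_arg ht, norm_smul, mul_pow, mul_assoc]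
  rw [integral_const_mul, Real.norm_of_nonneg ht.le, smul_eq_mul, pow_add, mul_assoc]

/-- This is the statement that the standard Gaussian has variance `1`, with the normalizing constant
cleared. -/
theorem integral_sq_mul_exp_neg_half_sq :
    ∫ u : ℝ, u * u * Real.exp (-(1 / 2) * u ^ 2) = ∫ u : ℝ, Real.exp (-(1 / 2) * u ^ 2) := by
  have h := ProbabilityTheory.variance_id_gaussianReal (μ := 0) (v := 1)
  rw [ProbabilityTheory.variance_of_integral_eq_zero (by fun_prop) (by simp),
    ProbabilityTheory.integral_gaussianReal_eq_integral_smul one_ne_zero] at h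
  simp only [ProbabilityTheory.gaussianPDFReal, NNReal.coe_one, mul_one, id, sub_zero,
    smul_eq_mul] at h
  rw [integral_gaussian]
  have hs : √(2 * Real.pi) ≠ 0 := by positivity
  simp_rw [mul_assoc] at h
  rw [integral_const_mul] at h
  rw [inv_mul_eq_one₀ hs] at h
  rw [show Real.pi / (1 / 2) = 2 * Real.pi by ring, h]
  congr 1; ext u
  rw [show -(1 / 2) * u ^ 2 = -u ^ 2 / 2 by ring]
  ring

theorem integral_mul_exp_neg_half_sq :
    ∫ u : ℝ, u * Real.exp (-(1 / 2) * u ^ 2) = 0 := by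
  have h := integral_neg_eq_self (fun u : ℝ => u * Real.exp (-(1 / 2) * u ^ 2)) volume
  simp only [neg_mul, neg_sq, integral_neg] at h
  simp only [neg_mul]
  linarith

theorem integral_euclideanSpace_prod (f : Fin d → ℝ → ℝ) :
    ∫ s : EuclideanSpace ℝ (Fin d), ∏ i, f i (s i) = ∏ i, ∫ u, f i u := by
  rw [← integral_fintype_prod_volume_eq_prod]
  exact (EuclideanSpace.volume_preserving_symm_measurableEquiv_toLp (Fin d)).integral_comp
    (MeasurableEquiv.measurableEmbedding _) (fun y : Fin d → ℝ => ∏ i, f i (y i))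

theorem exp_neg_half_norm_sq_eq_prod (s : EuclideanSpace ℝ (Fin d)) :
    Real.exp (-(1 / 2) * ‖s‖ ^ 2) = ∏ k, Real.exp (-(1 / 2) * s k ^ 2) := by
  rw [← Real.exp_sum, ← Finset.mul_sum, EuclideanSpace.real_norm_sq_eq]

theorem integral_coord_mul_coord_gaussian (i j : Fin d) :
    ∫ s : EuclideanSpace ℝ (Fin d), s i * s j * Real.exp (-(1 / 2) * ‖s‖ ^ 2) =
      if i = j then ∫ s : EuclideanSpace ℝ (Fin d), Real.exp (-(1 / 2) * ‖s‖ ^ 2) else 0 := by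
  -- Indicator factors turn the integrand into a product of functions of single coordinates, also
  -- when `i = j`, so that Fubini applies.
  have key : ∀ s : EuclideanSpace ℝ (Fin d), s i * s j * Real.exp (-(1 / 2) * ‖s‖ ^ 2) =
      ∏ k, ((if k = i then s k else 1) * (if k = j then s k else 1) *
        Real.exp (-(1 / 2) * s k ^ 2)) := by
    intro s
    rw [exp_neg_half_norm_sq_eq_prod, Finset.prod_mul_distrib, Finset.prod_mul_distrib]
    simp
  simp_rw [key]
  rw [integral_euclideanSpace_prod (fun k u => (if k = i then u else 1) * (if k = j then u else 1) *
        Real.exp (-(1 / 2) * u ^ 2))]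
  split_ifs with hij
  · subst hij
    simp_rw [exp_neg_half_norm_sq_eq_prod]
    rw [integral_euclideanSpace_prod (fun _ u => Real.exp (-(1 / 2) * u ^ 2))]
    refine Finset.prod_congr rfl fun k _ => ?_
    by_cases hk : k = i
    · simp only [hk, if_true]
      exact integral_sq_mul_exp_neg_half_sq
    · simp [hk]
  · refine Finset.prod_eq_zero (Finset.mem_univ i) ?_
    simp only [if_true, hij, if_false, mul_one]
    exact integral_mul_exp_neg_half_sq

/-- The second-moment matrix of the Gaussian is a multiple of the identity, so only the trace of `B`
survives. This is where the sum over an orthonormal frame comes from. -/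
theorem integral_gaussian_smul_bilin {G : Type*} [NormedAddCommGroup G] [NormedSpace ℝ G]
    [CompleteSpace G] (B : EuclideanSpace ℝ (Fin d) →L[ℝ] EuclideanSpace ℝ (Fin d) →L[ℝ] G) :
    ∫ s : EuclideanSpace ℝ (Fin d), Real.exp (-(1 / 2) * ‖s‖ ^ 2) • B s s =
      (∫ s : EuclideanSpace ℝ (Fin d), Real.exp (-(1 / 2) * ‖s‖ ^ 2)) •
        ∑ i, B (EuclideanSpace.single i 1) (EuclideanSpace.single i 1) := by
  have hexp : ∀ s : EuclideanSpace ℝ (Fin d), Real.exp (-(1 / 2) * ‖s‖ ^ 2) • B s s =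
      ∑ i, ∑ j, (s i * s j * Real.exp (-(1 / 2) * ‖s‖ ^ 2)) •
        B (EuclideanSpace.single i 1) (EuclideanSpace.single j 1) := by
    intro s
    have hs : s = ∑ i, s i • EuclideanSpace.single i (1 : ℝ) := by
      ext k
      simp [Finset.sum_apply, Pi.single_apply]
    have hB : B s s = B (∑ i, s i • EuclideanSpace.single i (1 : ℝ))
        (∑ j, s j • EuclideanSpace.single j (1 : ℝ)) := by rw [← hs]
    rw [hB]
    simp only [map_sum, map_smul, sum_apply, smul_apply, Finset.smul_sum, smul_smul]
    rw [Finset.sum_comm]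
    refine Finset.sum_congr rfl fun i _ => Finset.sum_congr rfl fun j _ => ?_
    congr 1; ring
  have hint : ∀ i j : Fin d, Integrable (fun s : EuclideanSpace ℝ (Fin d) =>
      (s i * s j * Real.exp (-(1 / 2) * ‖s‖ ^ 2)) •
        B (EuclideanSpace.single i 1) (EuclideanSpace.single j 1)) := by
    intro i j
    refine Integrable.smul_const ?_ _
    refine (integrable_norm_pow_mul_gaussian 2).mono' (by fun_prop)
      (Eventually.of_forall fun s => ?_)
    rw [norm_mul, norm_mul, Real.norm_of_nonneg (Real.exp_pos _).le, sq]
    gcongr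
    · exact PiLp.norm_apply_le s i
    · exact PiLp.norm_apply_le s j
  rw [funext hexp, integral_finsetSum _ fun i _ => integrable_finsetSum _ fun j _ => hint i j,
    Finset.smul_sum]
  refine Finset.sum_congr rfl fun i _ => ?_
  rw [integral_finsetSum _ fun j _ => hint i j]
  simp_rw [integral_smul_const, integral_coord_mul_coord_gaussian]
  simp

end Gaussian

/-! ### Gaussian integrals on a small ball -/

section LaplaceBall

variable {d : ℕ} {G : Type*} [NormedAddCommGroup G] [NormedSpace ℝ G]

theorem norm_setIntegral_gaussian_le {f : EuclideanSpace ℝ (Fin d) → G}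
    {S : Set (EuclideanSpace ℝ (Fin d))} {C t : ℝ} (hC : 0 ≤ C)
    (ht : 0 < t) (m : ℕ)
    (hf : ∀ᵐ s ∂(volume.restrict S), ‖f s‖ ≤
      C * (‖s‖ ^ m * Real.exp (-‖s‖ ^ 2 / (2 * t ^ 2)))) :
    ‖∫ s in S, f s‖ ≤ C * (t ^ (d + m) *
      ∫ s : EuclideanSpace ℝ (Fin d), ‖s‖ ^ m * Real.exp (-(1 / 2) * ‖s‖ ^ 2)) := by
  have hI := integrable_norm_pow_mul_gaussian_scaled (d := d) m ht
  refine (norm_integral_le_of_norm_le (hI.const_mul C).integrableOn hf).trans ?_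
  rw [integral_const_mul, ← integral_norm_pow_mul_gaussian_scaled m ht]
  refine mul_le_mul_of_nonneg_left ?_ hC
  exact setIntegral_le_integral hI (Eventually.of_forall fun s => by positivity)

theorem setIntegral_ball_comp_neg (r : ℝ) (f : EuclideanSpace ℝ (Fin d) → G) :
    ∫ s in Metric.ball 0 r, f (-s) = ∫ s in Metric.ball 0 r, f s := by
  have h := (Measure.measurePreserving_neg (volume : Measure (EuclideanSpace ℝ (Fin d)))).setIntegral_preimage_emb
    (MeasurableEquiv.neg _).measurableEmbedding f (Metric.ball 0 r)
  have h2 : Neg.neg ⁻¹' Metric.ball (0 : EuclideanSpace ℝ (Fin d)) r = Metric.ball 0 r := by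
    ext s; simp
  rw [h2] at h
  exact h

/-- The one-sided bound `a ≤ φ` keeps the full weight `exp (-a / τ)` in the error, and `1 - e^(-u) ≤
u` handles the change of exponent. With `τ = 2 t²`, the term `N ^ 4 / τ` has the same order as `N ^
2`. -/
theorem abs_mul_exp_neg_sub_exp_neg_le {J a φ C N τ : ℝ} (hτ : 0 < τ) (hJ : |J - 1| ≤ C * N ^ 2)
    (h1 : a ≤ φ) (h2 : φ ≤ a + C * N ^ 4) (hC : 0 ≤ C) :
    |J * Real.exp (-φ / τ) - Real.exp (-a / τ)| ≤
      (C * N ^ 2 + C * N ^ 4 / τ) * Real.exp (-a / τ) := by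
  have e1 : Real.exp (-φ / τ) ≤ Real.exp (-a / τ) := Real.exp_le_exp.2 (by gcongr)
  have e2 : Real.exp (-a / τ) - Real.exp (-φ / τ) ≤ C * N ^ 4 / τ * Real.exp (-a / τ) := by
    have h3 : Real.exp (-φ / τ) = Real.exp (-a / τ) * Real.exp (-((φ - a) / τ)) := by
      rw [← Real.exp_add]; congr 1; ring
    have h4 := Real.add_one_le_exp (-((φ - a) / τ))
    have h5 : (φ - a) / τ ≤ C * N ^ 4 / τ := by gcongr; linarith
    rw [h3]
    nlinarith [Real.exp_pos (-a / τ)]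
  calc |J * Real.exp (-φ / τ) - Real.exp (-a / τ)|
      = |(J - 1) * Real.exp (-φ / τ) - (Real.exp (-a / τ) - Real.exp (-φ / τ))| := by
        congr 1; ring
    _ ≤ |(J - 1) * Real.exp (-φ / τ)| + |Real.exp (-a / τ) - Real.exp (-φ / τ)| := abs_sub _ _
    _ ≤ C * N ^ 2 * Real.exp (-a / τ) + C * N ^ 4 / τ * Real.exp (-a / τ) := by
        rw [abs_mul, abs_of_pos (Real.exp_pos _), abs_of_nonneg (sub_nonneg.2 e1)]
        gcongr
    _ = _ := by ring

/-- Comparison of a perturbed Gaussian integral over a ball with an exact Gaussian integral. -/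
theorem exists_norm_gaussian_ball_sub_le {F Q : EuclideanSpace ℝ (Fin d) → G}
    {J φ : EuclideanSpace ℝ (Fin d) → ℝ} {r C : ℝ} {p : ℕ} (hr : 0 < r) (hC : 0 ≤ C)
    (hJm : AEStronglyMeasurable J (volume.restrict (Metric.ball 0 r)))
    (hφm : AEStronglyMeasurable φ (volume.restrict (Metric.ball 0 r)))
    (hFm : AEStronglyMeasurable F (volume.restrict (Metric.ball 0 r)))
    (hQm : Continuous Q)
    (hJ : ∀ᵐ s ∂(volume.restrict (Metric.ball 0 r)), |J s - 1| ≤ C * ‖s‖ ^ 2)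
    (hφ : ∀ s ∈ Metric.ball 0 r, ‖s‖ ^ 2 ≤ φ s ∧ φ s ≤ ‖s‖ ^ 2 + C * ‖s‖ ^ 4)
    (hF : ∀ s ∈ Metric.ball 0 r, ‖F s‖ ≤ C * ‖s‖ ^ p)
    (hFQ : ∀ s ∈ Metric.ball 0 r, ‖F s + F (-s) - (2 : ℝ) • Q s‖ ≤ C * ‖s‖ ^ (p + 2))
    (hQ : ∀ s, ‖Q s‖ ≤ C * ‖s‖ ^ p) :
    ∃ C' : ℝ, ∀ t > 0, ‖(∫ s in Metric.ball 0 r, J s • Real.exp (-φ s / (2 * t ^ 2)) • F s) -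
      ∫ s, Real.exp (-‖s‖ ^ 2 / (2 * t ^ 2)) • Q s‖ ≤ C' * t ^ (d + p + 2) := by
  set m : ℕ → ℝ := fun q =>
    ∫ s : EuclideanSpace ℝ (Fin d), ‖s‖ ^ q * Real.exp (-(1 / 2) * ‖s‖ ^ 2) with hm
  -- The four terms come from the density, the perturbed exponent, the even part of `F` minus `2 Q`,
  -- and the tail of `Q` outside the ball.
  refine ⟨C * C * m (p + 2) + C * C / 2 * m (p + 4) + C / 2 * m (p + 2) + C / r ^ 2 * m (p + 2),
    fun t ht => ?_⟩
  set B := Metric.ball (0 : EuclideanSpace ℝ (Fin d)) r with hB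
  have hBm : MeasurableSet B := measurableSet_ball
  set w : EuclideanSpace ℝ (Fin d) → ℝ := fun s => Real.exp (-‖s‖ ^ 2 / (2 * t ^ 2)) with hw
  have hwc : Continuous w := by fun_prop
  have hw0 : ∀ s, 0 < w s := fun s => Real.exp_pos _
  have hwneg : ∀ s, w (-s) = w s := fun s => by simp [hw]
  have hI : ∀ q, Integrable (fun s : EuclideanSpace ℝ (Fin d) => ‖s‖ ^ q * w s) := fun q =>
    integrable_norm_pow_mul_gaussian_scaled q ht
  have hmB : ∀ᵐ s ∂(volume.restrict B), s ∈ B := ae_restrict_mem hBm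
  have hτ : 0 < 2 * t ^ 2 := by positivity
  set D : EuclideanSpace ℝ (Fin d) → ℝ := fun s => J s * Real.exp (-φ s / (2 * t ^ 2)) - w s with hD
  have hDb : ∀ᵐ s ∂(volume.restrict B), |D s| ≤ (C * ‖s‖ ^ 2 + C * ‖s‖ ^ 4 / (2 * t ^ 2)) * w s := by
    filter_upwards [hJ, hmB] with s hJs hs
    exact abs_mul_exp_neg_sub_exp_neg_le hτ hJs (hφ s hs).1 (hφ s hs).2 hC
  have hDm : AEStronglyMeasurable D (volume.restrict B) := by
    refine (hJm.mul ?_).sub hwc.aestronglyMeasurable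
    exact Real.continuous_exp.comp_aestronglyMeasurable
      (hφm.neg.mul (aestronglyMeasurable_const (b := (2 * t ^ 2)⁻¹)))
  have iwF : IntegrableOn (fun s => w s • F s) B := by
    refine Integrable.mono' ((hI p).const_mul C).integrableOn
      (hwc.aestronglyMeasurable.smul hFm) ?_
    filter_upwards [hmB] with s hs
    rw [norm_smul, Real.norm_of_nonneg (hw0 s).le]
    nlinarith [hF s hs, hw0 s]
  have iDF : IntegrableOn (fun s => D s • F s) B := by
    refine Integrable.mono' (((hI (p + 2)).const_mul (C * C)).add
      ((hI (p + 4)).const_mul (C * C / (2 * t ^ 2)))).integrableOn (hDm.smul hFm) ?_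
    filter_upwards [hmB, hDb] with s hs hDs
    rw [norm_smul, Real.norm_eq_abs]
    refine (mul_le_mul hDs (hF s hs) (norm_nonneg _) ((abs_nonneg _).trans hDs)).trans (le_of_eq ?_)
    simp only [Pi.add_apply]
    ring
  have iwQ : Integrable (fun s => w s • Q s) := by
    refine Integrable.mono' ((hI p).const_mul C)
      (hwc.aestronglyMeasurable.smul hQm.aestronglyMeasurable) (Eventually.of_forall fun s => ?_)
    rw [norm_smul, Real.norm_of_nonneg (hw0 s).le]
    nlinarith [hQ s, hw0 s]
  have iwFn : IntegrableOn (fun s => w s • F (-s)) B := by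
    have h2 : Neg.neg ⁻¹' B = B := by ext s; simp [hB]
    have := ((Measure.measurePreserving_neg (volume : Measure (EuclideanSpace ℝ (Fin d)))).integrableOn_comp_preimage
      (MeasurableEquiv.neg _).measurableEmbedding (f := fun s => w s • F s) (s := B)).2 iwF
    rw [h2] at this
    simpa [Function.comp_def, hwneg] using this
  have e1 : ∫ s in B, J s • Real.exp (-φ s / (2 * t ^ 2)) • F s =
      (∫ s in B, D s • F s) + ∫ s in B, w s • F s := by
    rw [← integral_add iDF iwF]
    refine integral_congr_ae (Eventually.of_forall fun s => ?_)
    simp only [hD, smul_smul, ← add_smul, sub_add_cancel]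
  have e2 : ∫ s in B, w s • F (-s) = ∫ s in B, w s • F s := by
    rw [← setIntegral_ball_comp_neg r (fun s => w s • F s)]
    simp only [hwneg, hB]
  -- The weight and the ball are symmetric, so `F` may be averaged with its reflection, which
  -- removes the odd term of order `p + 1`.
  have e3 : ∫ s in B, w s • F s = (∫ s in B, ((1 / 2 : ℝ) * w s) • (F s + F (-s) - (2 : ℝ) • Q s)) +
      ∫ s in B, w s • Q s := by
    have h1 : ∫ s in B, ((1 / 2 : ℝ) * w s) • (F s + F (-s) - (2 : ℝ) • Q s) =
        (1 / 2 : ℝ) • ((∫ s in B, w s • F s) + (∫ s in B, w s • F (-s))) -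
          ∫ s in B, w s • Q s := by
      rw [← integral_add iwF iwFn, ← integral_smul, ← integral_sub _ iwQ.integrableOn]
      · refine integral_congr_ae (Eventually.of_forall fun s => ?_)
        simp only
        module
      · exact (iwF.add iwFn).smul (1 / 2 : ℝ)
    rw [h1, e2]
    module
  have e4 : ∫ s, w s • Q s = (∫ s in B, w s • Q s) + ∫ s in Bᶜ, w s • Q s :=
    (integral_add_compl hBm iwQ).symm
  have b1 : ‖∫ s in B, D s • F s‖ ≤ C * C * (t ^ (d + (p + 2)) * m (p + 2)) +
      C * C / (2 * t ^ 2) * (t ^ (d + (p + 4)) * m (p + 4)) := by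
    have hIs := (((hI (p + 2)).const_mul (C * C)).add
      ((hI (p + 4)).const_mul (C * C / (2 * t ^ 2))))
    refine (norm_integral_le_of_norm_le hIs.integrableOn ?_).trans
      ((setIntegral_le_integral hIs (Eventually.of_forall fun s => ?_)).trans (le_of_eq ?_))
    · filter_upwards [hmB, hDb] with s hs hDs
      rw [norm_smul, Real.norm_eq_abs]
      refine (mul_le_mul hDs (hF s hs) (norm_nonneg _) ((abs_nonneg _).trans hDs)).trans
        (le_of_eq ?_)
      simp only [Pi.add_apply]
      ring
    · have := (hw0 s).le
      simp only [Pi.zero_apply, Pi.add_apply]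
      positivity
    · simp only [Pi.add_apply]
      rw [integral_add ((hI (p + 2)).const_mul (C * C)) ((hI (p + 4)).const_mul _),
        integral_const_mul, integral_const_mul, integral_norm_pow_mul_gaussian_scaled _ ht,
        integral_norm_pow_mul_gaussian_scaled _ ht]
  have b2 : ‖∫ s in B, ((1 / 2 : ℝ) * w s) • (F s + F (-s) - (2 : ℝ) • Q s)‖ ≤
      C / 2 * (t ^ (d + (p + 2)) * m (p + 2)) := by
    refine norm_setIntegral_gaussian_le (by positivity) ht _ ?_
    filter_upwards [hmB] with s hs
    rw [norm_smul, norm_mul, Real.norm_of_nonneg (hw0 s).le, Real.norm_of_nonneg (by norm_num)]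
    have := mul_le_mul_of_nonneg_left (hFQ s hs) (mul_nonneg (one_half_pos (α := ℝ)).le (hw0 s).le)
    refine this.trans (le_of_eq ?_)
    simp only [hw]; ring
  have b3 : ‖∫ s in Bᶜ, w s • Q s‖ ≤ C / r ^ 2 * (t ^ (d + (p + 2)) * m (p + 2)) := by
    refine norm_setIntegral_gaussian_le (by positivity) ht _ ?_
    filter_upwards [ae_restrict_mem hBm.compl] with s hs
    have hrs : r ≤ ‖s‖ := by simpa [hB] using hs
    rw [norm_smul, Real.norm_of_nonneg (hw0 s).le]
    -- Off the ball two extra powers of `‖s‖` may be inserted freely; after scaling they give the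
    -- required `t²`.
    have h1 : (1 : ℝ) ≤ ‖s‖ ^ 2 / r ^ 2 := by
      rw [one_le_div (by positivity)]; gcongr
    calc w s * ‖Q s‖ ≤ w s * (C * ‖s‖ ^ p) * 1 := by
          rw [mul_one]; exact mul_le_mul_of_nonneg_left (hQ s) (hw0 s).le
      _ ≤ w s * (C * ‖s‖ ^ p) * (‖s‖ ^ 2 / r ^ 2) := by
          have := (hw0 s).le
          gcongr
      _ = C / r ^ 2 * (‖s‖ ^ (p + 2) * w s) := by ring
  have hsplit : (∫ s in B, J s • Real.exp (-φ s / (2 * t ^ 2)) • F s) - ∫ s, w s • Q s =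
      (∫ s in B, D s • F s) +
        (∫ s in B, ((1 / 2 : ℝ) * w s) • (F s + F (-s) - (2 : ℝ) • Q s)) -
        ∫ s in Bᶜ, w s • Q s := by
    rw [e1, e3, e4]; abel
  rw [hsplit]
  calc _ ≤ _ := norm_sub_le _ _
    _ ≤ _ := add_le_add (norm_add_le _ _) le_rfl
    _ ≤ _ := add_le_add (add_le_add b1 b2) b3
    _ = _ := by
      have ht0 : t ≠ 0 := ht.ne'
      field_simp
      ring

end LaplaceBall

/-! ### Algebra of alternating arrays -/

section Arrays

variable {n k : ℕ}

theorem sign_mul_sign_cast (σ : Equiv.Perm (Fin k)) :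
    ((Equiv.Perm.sign σ : ℤ) : ℝ) * ((Equiv.Perm.sign σ : ℤ) : ℝ) = 1 := by
  rw [← Int.cast_mul, Int.units_coe_mul_self, Int.cast_one]

theorem pureTensor_comp_perm_apply (v : Fin k → EuclideanSpace ℝ (Fin n))
    (σ : Equiv.Perm (Fin k)) (i : Fin k → Fin n) :
    pureTensor (v ∘ σ) i = pureTensor v (i ∘ σ.symm) :=
  Fintype.prod_equiv σ _ _ fun j => by simp

theorem inner_pureTensor_comp_perm {A : KArray n k} (hA : A ∈ antisymmetricArrays n k)
    (v : Fin k → EuclideanSpace ℝ (Fin n)) (σ : Equiv.Perm (Fin k)) :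
    inner ℝ A (pureTensor (v ∘ σ)) =
      ((Equiv.Perm.sign σ : ℤ) : ℝ) * inner ℝ A (pureTensor v) := by
  simp only [PiLp.inner_apply, Finset.mul_sum, pureTensor_comp_perm_apply]
  refine Fintype.sum_equiv (Equiv.arrowCongr σ (Equiv.refl (Fin n))) _ _ fun i => ?_
  have h3 : (Equiv.arrowCongr σ (Equiv.refl (Fin n))) i = i ∘ σ.symm := rfl
  have h2 : A (i ∘ σ.symm) = ((Equiv.Perm.sign σ : ℤ) : ℝ) * A i := by
    rw [← Equiv.Perm.sign_symm]; exact hA σ.symm i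
  rw [h3, h2]
  simp only [RCLike.inner_apply, conj_trivial]
  linear_combination (-(A i * pureTensor v (i ∘ σ.symm))) * sign_mul_sign_cast σ

/-- The alternating part of `v₁ ⊗ ⋯ ⊗ v_k`. -/
noncomputable def altPureTensor (v : Fin k → EuclideanSpace ℝ (Fin n)) : KArray n k :=
  (1 / (Nat.factorial k : ℝ)) •
    ∑ σ : Equiv.Perm (Fin k), ((Equiv.Perm.sign σ : ℤ) : ℝ) • pureTensor (v ∘ σ)

theorem altPureTensor_mem {V : Submodule ℝ (EuclideanSpace ℝ (Fin n))}
    {v : Fin k → EuclideanSpace ℝ (Fin n)} (hv : ∀ j, v j ∈ V) :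
    altPureTensor v ∈ alternatingArrays V k := by
  refine ⟨Submodule.smul_mem _ _ (Submodule.sum_mem _ fun σ _ => Submodule.smul_mem _ _
    (Submodule.subset_span ⟨v ∘ σ, fun j => hv _, rfl⟩)), ?_⟩
  intro τ i
  simp only [altPureTensor, PiLp.smul_apply, WithLp.ofLp_sum, Finset.sum_apply, smul_eq_mul]
  rw [mul_left_comm]
  congr 1
  rw [Finset.mul_sum]
  refine Fintype.sum_equiv (Equiv.mulRight τ.symm) _ _ fun σ => ?_
  have h1 : pureTensor (v ∘ ⇑σ) (fun j => i (τ j)) =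
      pureTensor (v ∘ ⇑(Equiv.mulRight τ.symm σ)) i := by
    rw [pureTensor_comp_perm_apply, pureTensor_comp_perm_apply]
    rfl
  simp only [h1, Equiv.coe_mulRight, Equiv.Perm.sign_mul,
    Units.val_mul, Int.cast_mul, Equiv.Perm.sign_symm]
  linear_combination (-((Equiv.Perm.sign σ : ℤ) : ℝ) *
    pureTensor (v ∘ ⇑(σ * τ.symm)) i) * sign_mul_sign_cast τ

theorem inner_altPureTensor {A : KArray n k} (hA : A ∈ antisymmetricArrays n k)
    (v : Fin k → EuclideanSpace ℝ (Fin n)) :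
    inner ℝ A (altPureTensor v) = inner ℝ A (pureTensor v) := by
  have hk : (Nat.factorial k : ℝ) ≠ 0 := by exact_mod_cast Nat.factorial_ne_zero k
  simp only [altPureTensor, inner_smul_right, inner_sum, inner_pureTensor_comp_perm hA,
    ← mul_assoc, sign_mul_sign_cast]
  simp [Fintype.card_perm]
  field_simp

/-- An antisymmetric array sees only the alternating part of a pure tensor. For vectors in `V` that
part lies in the range of the projection, so the projection, being self-adjoint, is invisible to the
pairing. -/
theorem inner_starProjection_pureTensor {V : Submodule ℝ (EuclideanSpace ℝ (Fin n))}
    {A : KArray n k} (hA : A ∈ antisymmetricArrays n k)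
    {v : Fin k → EuclideanSpace ℝ (Fin n)} (hv : ∀ j, v j ∈ V) :
    inner ℝ ((alternatingArrays V k).starProjection A) (pureTensor v) =
      inner ℝ A (pureTensor v) := by
  have hP : (alternatingArrays V k).starProjection A ∈ alternatingArrays V k :=
    Submodule.starProjection_apply_mem _ _
  rw [← inner_altPureTensor hP.2, ← inner_altPureTensor hA,
    Submodule.inner_starProjection_left_eq_right,
    Submodule.starProjection_eq_self_iff.2 (altPureTensor_mem hv)]

theorem eq_of_inner_pureTensor_eq {V : Submodule ℝ (EuclideanSpace ℝ (Fin n))} {A B : KArray n k}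
    (hA : A ∈ alternatingArrays V k) (hB : B ∈ alternatingArrays V k)
    (h : ∀ v : Fin k → EuclideanSpace ℝ (Fin n), (∀ j, v j ∈ V) →
      inner ℝ A (pureTensor v) = inner ℝ B (pureTensor v)) : A = B := by
  have key : ∀ T ∈ tensorPower V k, inner ℝ (A - B) T = 0 := by
    intro T hT
    induction hT using Submodule.span_induction with
    | mem x hx =>
      obtain ⟨v, hv, rfl⟩ := hx
      rw [inner_sub_left, h v hv, sub_self]
    | zero => simp
    | add x y _ _ hx hy => rw [inner_add_right, hx, hy, add_zero]
    | smul c x _ hx => rw [inner_smul_right, hx, mul_zero]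
  exact sub_eq_zero.1 (inner_self_eq_zero.1 (key _ (Submodule.sub_mem _ hA.1 hB.1)))

/-! ### The wedge product with a vector, paired with pure tensors -/

theorem vecWedge_mem_antisymmetricArrays (v : EuclideanSpace ℝ (Fin n)) (A : KArray n k) :
    vecWedge v A ∈ antisymmetricArrays n (k + 1) := by
  intro τ i
  simp only [vecWedge]
  rw [mul_left_comm]
  congr 1
  rw [Finset.mul_sum]
  refine Fintype.sum_equiv (Equiv.mulLeft τ) _ _ fun σ => ?_
  simp only [Equiv.coe_mulLeft, Equiv.Perm.sign_mul, Units.val_mul, Int.cast_mul,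
    Equiv.Perm.coe_mul, Function.comp_apply]
  linear_combination (-((Equiv.Perm.sign σ : ℤ) : ℝ) *
    (v (i (τ (σ 0))) * A (fun j => i (τ (σ j.succ))))) * sign_mul_sign_cast τ

theorem inner_pureTensor_cons (v : EuclideanSpace ℝ (Fin n)) (A : KArray n k)
    (w : Fin (k + 1) → EuclideanSpace ℝ (Fin n)) :
    ∑ i : Fin (k + 1) → Fin n, v (i 0) * A (fun j => i j.succ) * pureTensor w i =
      inner ℝ v (w 0) * inner ℝ A (pureTensor fun j => w j.succ) := by
  rw [← (Fin.consEquiv fun _ => Fin n).sum_comp, Fintype.sum_prod_type]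
  simp only [PiLp.inner_apply, Finset.sum_mul_sum, pureTensor, Fin.prod_univ_succ]
  refine Finset.sum_congr rfl fun a _ => Finset.sum_congr rfl fun i _ => ?_
  simp [Fin.consEquiv]
  ring

theorem inner_vecWedge_eq_sum_perm (v : EuclideanSpace ℝ (Fin n)) (A : KArray n k)
    (w : Fin (k + 1) → EuclideanSpace ℝ (Fin n)) :
    inner ℝ (vecWedge v A) (pureTensor w) = (1 / (Nat.factorial k : ℝ)) *
      ∑ σ : Equiv.Perm (Fin (k + 1)), ((Equiv.Perm.sign σ : ℤ) : ℝ) *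
        (inner ℝ v (w (σ 0)) * inner ℝ A (pureTensor fun j => w (σ j.succ))) := by
  have h1 : inner ℝ (vecWedge v A) (pureTensor w) = (1 / (Nat.factorial k : ℝ)) *
      ∑ i : Fin (k + 1) → Fin n, ∑ σ : Equiv.Perm (Fin (k + 1)), ((Equiv.Perm.sign σ : ℤ) : ℝ) *
        (v (i (σ 0)) * A (fun j => i (σ j.succ)) * pureTensor w i) := by
    simp only [PiLp.inner_apply, vecWedge, RCLike.inner_apply, conj_trivial, Finset.mul_sum]
    refine Finset.sum_congr rfl fun i _ => Finset.sum_congr rfl fun σ _ => ?_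
    ring
  rw [h1, Finset.sum_comm]
  congr 1
  refine Finset.sum_congr rfl fun σ _ => ?_
  rw [← Finset.mul_sum]
  congr 1
  have := inner_pureTensor_cons v A (w ∘ σ)
  simp only [Function.comp_apply] at this
  rw [← this]
  refine Fintype.sum_equiv (Equiv.arrowCongr σ.symm (Equiv.refl (Fin n))) _ _ fun i => ?_
  have h3 : (Equiv.arrowCongr σ.symm (Equiv.refl (Fin n))) i = i ∘ σ := rfl
  rw [h3, pureTensor_comp_perm_apply]
  simp [Function.comp_assoc]

/-- Group the permutations by the value `p` of `σ 0`. By antisymmetry of `A` the `k!` members of a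
group contribute equally, which cancels `1 / k!`. The result has the shape of the alternating sum in
the exterior derivative. -/
theorem inner_vecWedge_pureTensor (v : EuclideanSpace ℝ (Fin n)) {A : KArray n k}
    (hA : A ∈ antisymmetricArrays n k) (w : Fin (k + 1) → EuclideanSpace ℝ (Fin n)) :
    inner ℝ (vecWedge v A) (pureTensor w) = ∑ p : Fin (k + 1),
      (-1 : ℝ) ^ (p : ℕ) * (inner ℝ v (w p) * inner ℝ A (pureTensor (p.removeNth w))) := by
  have hk : (Nat.factorial k : ℝ) ≠ 0 := by exact_mod_cast Nat.factorial_ne_zero k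
  rw [inner_vecWedge_eq_sum_perm, Finset.univ_perm_fin_succ, ← Finset.univ_product_univ]
  simp only [Finset.sum_map, Equiv.toEmbedding_apply, Finset.sum_product, Finset.mul_sum]
  refine Finset.sum_congr rfl fun p _ => ?_
  have key : ∀ e : Equiv.Perm (Fin k),
      ((Equiv.Perm.sign (Equiv.Perm.decomposeFin.symm (p, e)) : ℤ) : ℝ) *
        (inner ℝ v (w (Equiv.Perm.decomposeFin.symm (p, e) 0)) *
          inner ℝ A (pureTensor fun j => w (Equiv.Perm.decomposeFin.symm (p, e) j.succ))) =
      (-1 : ℝ) ^ (p : ℕ) * (inner ℝ v (w p) * inner ℝ A (pureTensor (p.removeNth w))) := by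
    intro e
    rw [Equiv.Perm.decomposeFin.symm_sign, Equiv.Perm.decomposeFin_symm_apply_zero]
    simp only [Equiv.Perm.decomposeFin_symm_apply_succ]
    refine Fin.cases ?_ (fun q => ?_) p
    · have h1 : (fun j : Fin k => w (Equiv.swap 0 0 (e j).succ)) =
          ((0 : Fin (k + 1)).removeNth w) ∘ e := by
        ext j; simp [Fin.tail]
      rw [h1, inner_pureTensor_comp_perm hA]
      simp only [if_true, one_mul, Fin.val_zero, pow_zero]
      linear_combination (inner ℝ v (w 0) *
        inner ℝ A (pureTensor ((0 : Fin (k + 1)).removeNth w))) * sign_mul_sign_cast e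
    -- The remaining indices are the increasing enumeration of the complement of `q.succ`, permuted
    -- by `q.cycleRange * e`. The cycle has sign `(-1) ^ q`, and the swap supplies the last minus
    -- sign.
    · have h1 : (fun j : Fin k => w (Equiv.swap 0 q.succ (e j).succ)) =
          (q.succ.removeNth w) ∘ (q.cycleRange * e) := by
        ext j; simp [Fin.removeNth, Fin.succAbove_cycleRange]
      rw [h1, inner_pureTensor_comp_perm hA]
      simp only [Fin.succ_ne_zero, if_false, Equiv.Perm.sign_mul, Units.val_mul, Int.cast_mul,
        Fin.sign_cycleRange, Fin.val_succ, pow_succ]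
      push_cast
      linear_combination (-(-1 : ℝ) ^ (q : ℕ) * inner ℝ v (w q.succ) *
        inner ℝ A (pureTensor (q.succ.removeNth w))) * sign_mul_sign_cast e
  rw [Finset.sum_congr rfl fun e _ => congrArg _ (key e)]
  simp [Fintype.card_perm]
  field_simp

/-- The wedge product of a vector and an array as a continuous bilinear map. -/
noncomputable def vecWedgeL (n k : ℕ) :
    EuclideanSpace ℝ (Fin n) →L[ℝ] KArray n k →L[ℝ] KArray n (k + 1) :=
  LinearMap.toContinuousBilinearMap <| LinearMap.mk₂ ℝ vecWedge
    (fun v v' A => by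
      ext i
      simp only [vecWedge, PiLp.add_apply, ← mul_add, ← Finset.sum_add_distrib, add_mul])
    (fun c v A => by
      ext i
      simp only [vecWedge, PiLp.smul_apply, smul_eq_mul, Finset.mul_sum]
      exact Finset.sum_congr rfl fun σ _ => by ring)
    (fun v A A' => by
      ext i
      simp only [vecWedge, PiLp.add_apply, ← mul_add, ← Finset.sum_add_distrib])
    (fun c v A => by
      ext i
      simp only [vecWedge, PiLp.smul_apply, smul_eq_mul, Finset.mul_sum]
      exact Finset.sum_congr rfl fun σ _ => by ring)

theorem vecWedgeL_apply (v : EuclideanSpace ℝ (Fin n)) (A : KArray n k) :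
    vecWedgeL n k v A = vecWedge v A := rfl

/-- The alternating form of an array, as a continuous linear map. -/
noncomputable def arrayFormL (n k : ℕ) :
    KArray n k →L[ℝ] EuclideanSpace ℝ (Fin n) [⋀^Fin k]→L[ℝ] ℝ :=
  LinearMap.toContinuousLinearMap
    { toFun := arrayForm
      map_add' := fun A B => by
        ext v
        simp only [arrayForm, ContinuousAlternatingMap.smul_apply,
          ContinuousAlternatingMap.add_apply,
          ContinuousMultilinearMap.alternatization_apply_apply, arrayMultilinear_apply,
          inner_add_left, smul_add, Finset.sum_add_distrib]
      map_smul' := fun c A => by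
        ext v
        simp only [arrayForm, ContinuousAlternatingMap.smul_apply,
          ContinuousMultilinearMap.alternatization_apply_apply, arrayMultilinear_apply,
          inner_smul_left, RingHom.id_apply, Finset.mul_sum, conj_trivial, smul_eq_mul,
          Units.smul_def, zsmul_eq_mul]
        exact Finset.sum_congr rfl fun σ _ => by ring }

theorem arrayFormL_apply (A : KArray n k) : arrayFormL n k A = arrayForm A := rfl

end Arrays

/-! ### Submanifolds as graphs over their tangent spaces -/

section GraphChart

variable {n d : ℕ}

/-- `ψ` parametrizes the neighbourhood `U ∩ M` of `x` in `M` as a graph over a ball of the tangent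
space at `x`, where the tangent space is identified with `ℝᵈ` by the linear isometry `ι`. -/
structure IsGraphChart (M : Set (EuclideanSpace ℝ (Fin n))) (x : EuclideanSpace ℝ (Fin n))
    (ι : EuclideanSpace ℝ (Fin d) →ₗᵢ[ℝ] EuclideanSpace ℝ (Fin n))
    (ψ : EuclideanSpace ℝ (Fin d) → EuclideanSpace ℝ (Fin n)) (r : ℝ)
    (U : Set (EuclideanSpace ℝ (Fin n))) : Prop where
  pos : 0 < r
  isOpen : IsOpen U
  image_ball : ψ '' Metric.ball 0 r = U ∩ M
  map_zero : ψ 0 = x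
  continuousOn : ContinuousOn ψ (Metric.ball 0 r)
  hasFDerivAt : HasFDerivAt ψ ι.toContinuousLinearMap 0
  adjoint_sub : ∀ s ∈ Metric.ball 0 r,
    ContinuousLinearMap.adjoint ι.toContinuousLinearMap (ψ s - x) = s
  factors : ∃ (V : Set (EuclideanSpace ℝ (Fin d)))
    (φ : EuclideanSpace ℝ (Fin d) → EuclideanSpace ℝ (Fin n))
    (g : EuclideanSpace ℝ (Fin d) → EuclideanSpace ℝ (Fin d)),
    IsLocalParam M V φ ∧ ContDiffAt ℝ ∞ g 0 ∧ MapsTo g (Metric.ball 0 r) V ∧ EqOn ψ (φ ∘ g) (Metric.ball 0 r)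

theorem LinearIsometry.adjoint_apply_self
    (ι : EuclideanSpace ℝ (Fin d) →ₗᵢ[ℝ] EuclideanSpace ℝ (Fin n))
    (w : EuclideanSpace ℝ (Fin d)) :
    ContinuousLinearMap.adjoint ι.toContinuousLinearMap (ι w) = w := by
  refine ext_inner_right ℝ fun v => ?_
  rw [ContinuousLinearMap.adjoint_inner_left]
  exact ι.inner_map_map w v

theorem LinearIsometry.norm_adjoint_apply_le
    (ι : EuclideanSpace ℝ (Fin d) →ₗᵢ[ℝ] EuclideanSpace ℝ (Fin n))
    (y : EuclideanSpace ℝ (Fin n)) :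
    ‖ContinuousLinearMap.adjoint ι.toContinuousLinearMap y‖ ≤ ‖y‖ := by
  refine (ContinuousLinearMap.le_opNorm _ y).trans ?_
  have : ‖ContinuousLinearMap.adjoint ι.toContinuousLinearMap‖ ≤ 1 := by
    rw [LinearIsometryEquiv.norm_map]
    exact ι.norm_toContinuousLinearMap_le
  nlinarith [norm_nonneg y]

theorem IsLocalParam.mem {M : Set (EuclideanSpace ℝ (Fin n))} {V : Set (EuclideanSpace ℝ (Fin d))}
    {φ : EuclideanSpace ℝ (Fin d) → EuclideanSpace ℝ (Fin n)} (h : IsLocalParam M V φ)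
    {u : EuclideanSpace ℝ (Fin d)} (hu : u ∈ V) : φ u ∈ M := by
  obtain ⟨U, -, hU⟩ := h.isOpen_image V Subset.rfl h.isOpen
  exact (hU ▸ mem_image_of_mem φ hu : φ u ∈ U ∩ M).2

theorem IsLocalParam.contDiffAt {M : Set (EuclideanSpace ℝ (Fin n))}
    {V : Set (EuclideanSpace ℝ (Fin d))}
    {φ : EuclideanSpace ℝ (Fin d) → EuclideanSpace ℝ (Fin n)} (h : IsLocalParam M V φ)
    {u : EuclideanSpace ℝ (Fin d)} (hu : u ∈ V) : ContDiffAt ℝ ∞ φ u :=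
  h.smooth.contDiffAt (h.isOpen.mem_nhds hu)

/-- Velocities of smooth curves `s ↦ f (u + s w)` in `M` are tangent to `M`. -/
theorem fderiv_apply_mem_embTangentSpace {M : Set (EuclideanSpace ℝ (Fin n))}
    {f : EuclideanSpace ℝ (Fin d) → EuclideanSpace ℝ (Fin n)} {u : EuclideanSpace ℝ (Fin d)}
    (hf : ContDiffAt ℝ ∞ f u) (hM : ∀ᶠ v in 𝓝 u, f v ∈ M) (w : EuclideanSpace ℝ (Fin d)) :
    fderiv ℝ f u w ∈ embTangentSpace M (f u) := by
  have hu : u + (0 : ℝ) • w = u := by simp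
  have hl : ContDiffAt ℝ ∞ (fun s : ℝ => u + s • w) 0 := by fun_prop
  refine Submodule.subset_span ⟨fun s : ℝ => f (u + s • w), ?_, by simp, ?_, ?_⟩
  · exact ContDiffAt.comp (0 : ℝ) (by rwa [hu]) hl
  · have : Tendsto (fun s : ℝ => u + s • w) (𝓝 0) (𝓝 u) := by
      simpa using hl.continuousAt.tendsto
    exact this.eventually hM
  · have h1 : HasDerivAt (fun s : ℝ => u + s • w) w 0 := by
      simpa using ((hasDerivAt_id (0 : ℝ)).smul_const w).const_add u
    have h2 : HasFDerivAt f (fderiv ℝ f u) (u + (0 : ℝ) • w) := by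
      rw [hu]; exact (hf.differentiableAt (by simp)).hasFDerivAt
    exact (h2.comp_hasDerivAt (0 : ℝ) h1).deriv

theorem exists_linearIsometry_range_eq {A : EuclideanSpace ℝ (Fin d) →L[ℝ] EuclideanSpace ℝ (Fin n)}
    (hA : Function.Injective A) :
    ∃ ι : EuclideanSpace ℝ (Fin d) →ₗᵢ[ℝ] EuclideanSpace ℝ (Fin n),
      LinearMap.range ι.toLinearMap = LinearMap.range A.toLinearMap := by
  set E := LinearMap.range A.toLinearMap with hE
  have hfin : Module.finrank ℝ E = d := by
    rw [hE, LinearMap.finrank_range_of_inj hA, finrank_euclideanSpace_fin]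
  let b := (stdOrthonormalBasis ℝ E).reindex (finCongr hfin)
  refine ⟨E.subtypeₗᵢ.comp b.repr.symm.toLinearIsometry, ?_⟩
  ext y
  constructor
  · rintro ⟨w, rfl⟩
    exact (b.repr.symm w).2
  · intro hy
    exact ⟨b.repr ⟨y, hy⟩, by simp⟩

/-- Follow a parametrization by the orthogonal projection `L` to the tangent space. This is a local
diffeomorphism of `ℝᵈ` by the inverse function theorem, and reparametrizing by its inverse makes `M`
a graph. -/
theorem IsSubmanifold.exists_isGraphChart {M : Set (EuclideanSpace ℝ (Fin n))}
    (hM : IsSubmanifold d M) {x : EuclideanSpace ℝ (Fin n)} (hx : x ∈ M) :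
    ∃ ι ψ r U, IsGraphChart (d := d) M x ι ψ r U := by
  obtain ⟨V, φ, hφ, u₀, hu₀, rfl⟩ := hM x hx
  set A := fderiv ℝ φ u₀ with hA
  have hAinj : Function.Injective A := hφ.immersion u₀ hu₀
  obtain ⟨ι, hι⟩ := exists_linearIsometry_range_eq hAinj
  have hAι : ∀ w, ∃ z, ι z = A w := fun w => by
    have : A w ∈ LinearMap.range ι.toLinearMap := by rw [hι]; exact ⟨w, rfl⟩
    exact this
  set L := ContinuousLinearMap.adjoint ι.toContinuousLinearMap with hL
  -- On the range of `A`, which is the range of `ι`, the adjoint `L` inverts `ι`.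
  have hLinj : Function.Injective (L.toLinearMap ∘ₗ A.toLinearMap) := by
    intro w w' h
    obtain ⟨z, hz⟩ := hAι w
    obtain ⟨z', hz'⟩ := hAι w'
    have h1 : L (A w) = L (A w') := h
    rw [← hz, ← hz', hL, ι.adjoint_apply_self, ι.adjoint_apply_self] at h1
    exact hAinj (by rw [← hz, ← hz', h1])
  let f' : EuclideanSpace ℝ (Fin d) ≃L[ℝ] EuclideanSpace ℝ (Fin d) :=
    (LinearEquiv.ofInjectiveEndo _ hLinj).toContinuousLinearEquiv
  let f : EuclideanSpace ℝ (Fin d) → EuclideanSpace ℝ (Fin d) := fun u => L (φ u - φ u₀)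
  have hφat : ContDiffAt ℝ ∞ φ u₀ := hφ.contDiffAt hu₀
  have hf : ContDiffAt ℝ ∞ f u₀ :=
    L.contDiff.contDiffAt.comp u₀ (hφat.sub contDiffAt_const)
  have hφd : HasFDerivAt φ A u₀ := (hφat.differentiableAt (by simp)).hasFDerivAt
  have hfd : HasFDerivAt f (f' : EuclideanSpace ℝ (Fin d) →L[ℝ] EuclideanSpace ℝ (Fin d)) u₀ := by
    have := L.hasFDerivAt.comp u₀ (hφd.sub_const (φ u₀))
    refine this.congr_fderiv ?_
    ext w : 1
    rfl
  have hf0 : f u₀ = 0 := by simp [f]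
  let e := hf.toOpenPartialHomeomorph f hfd (by simp)
  have he : ∀ u, e u = f u := fun u => rfl
  have hsrc : u₀ ∈ e.source := hf.mem_toOpenPartialHomeomorph_source hfd (by simp)
  have htgt : (0 : EuclideanSpace ℝ (Fin d)) ∈ e.target := by
    rw [← hf0]; exact hf.image_mem_toOpenPartialHomeomorph_target hfd (by simp)
  have hsymm0 : e.symm 0 = u₀ := by
    rw [← hf0, ← he]; exact e.left_inv hsrc
  have hg : ContDiffAt ℝ ∞ e.symm 0 := by
    have := hf.to_localInverse hfd (by simp)
    rw [hf0] at this
    exact this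
  have hV : ∀ᶠ s in 𝓝 (0 : EuclideanSpace ℝ (Fin d)), s ∈ e.target ∧ e.symm s ∈ V := by
    have h1 : ∀ᶠ s in 𝓝 (0 : EuclideanSpace ℝ (Fin d)), s ∈ e.target :=
      e.open_target.mem_nhds htgt
    have h2 : ∀ᶠ s in 𝓝 (0 : EuclideanSpace ℝ (Fin d)), e.symm s ∈ V :=
      hg.continuousAt.eventually (by rw [hsymm0]; exact hφ.isOpen.mem_nhds hu₀)
    exact h1.and h2
  obtain ⟨r, hr, hball⟩ := Metric.eventually_nhds_iff_ball.1 hV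
  have hOV : e.symm '' Metric.ball 0 r ⊆ V := by
    rintro _ ⟨s, hs, rfl⟩; exact (hball s hs).2
  have hO : IsOpen (e.symm '' Metric.ball 0 r) :=
    e.symm.isOpen_image_of_subset_source Metric.isOpen_ball fun s hs => (hball s hs).1
  obtain ⟨U, hU, hUM⟩ := hφ.isOpen_image _ hOV hO
  have hinv : ∀ s ∈ Metric.ball (0 : EuclideanSpace ℝ (Fin d)) r,
      L (φ (e.symm s) - φ u₀) = s := fun s hs => e.right_inv (hball s hs).1
  have hψ0 : φ (e.symm 0) = φ u₀ := by rw [hsymm0]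
  have hψat : ContDiffAt ℝ ∞ (φ ∘ e.symm) 0 := by
    refine ContDiffAt.comp 0 ?_ hg
    rwa [hsymm0]
  refine ⟨ι, φ ∘ e.symm, r, U, hr, hU, by rw [image_comp, hUM], hψ0, ?_, ?_, hinv,
    V, φ, e.symm, hφ, hg, fun s hs => (hball s hs).2, fun s _ => rfl⟩
  · exact hφ.smooth.continuousOn.comp (e.symm.continuousOn.mono fun s hs => (hball s hs).1)
      fun s hs => (hball s hs).2
  · have hgd : HasFDerivAt e.symm (fderiv ℝ e.symm 0) 0 :=
      (hg.differentiableAt (by simp)).hasFDerivAt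
    have hφd' : HasFDerivAt φ A (e.symm 0) := by rwa [hsymm0]
    have h1 := hφd'.comp 0 hgd
    have h2 : HasFDerivAt (fun s => L ((φ ∘ e.symm) s - φ u₀))
        (L.comp (A.comp (fderiv ℝ e.symm 0))) 0 :=
      L.hasFDerivAt.comp 0 (h1.sub_const (φ u₀))
    have h3 : (fun s => L ((φ ∘ e.symm) s - φ u₀)) =ᶠ[𝓝 0] id := by
      filter_upwards [Metric.ball_mem_nhds 0 hr] with s hs using hinv s hs
    -- The derivative of `ψ` at `0` takes values in the range of `ι` and has `L` as left inverse;
    -- hence it is `ι`.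
    have h4 := h2.unique ((hasFDerivAt_id _).congr_of_eventuallyEq h3)
    refine h1.congr_fderiv ?_
    ext w : 1
    obtain ⟨z, hz⟩ := hAι (fderiv ℝ e.symm 0 w)
    have h5 : L (A (fderiv ℝ e.symm 0 w)) = w := congrArg (fun T => T w) h4
    rw [← hz, hL, ι.adjoint_apply_self] at h5
    change A (fderiv ℝ e.symm 0 w) = ι w
    rw [← hz, h5]

/-! ### Local inverse, smoothness and tangent space in a graph chart -/

namespace IsGraphChart

variable {M : Set (EuclideanSpace ℝ (Fin n))} {x : EuclideanSpace ℝ (Fin n)}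
    {ι : EuclideanSpace ℝ (Fin d) →ₗᵢ[ℝ] EuclideanSpace ℝ (Fin n)}
    {ψ : EuclideanSpace ℝ (Fin d) → EuclideanSpace ℝ (Fin n)} {r : ℝ}
    {U : Set (EuclideanSpace ℝ (Fin n))}

theorem zero_mem (h : IsGraphChart M x ι ψ r U) :
    (0 : EuclideanSpace ℝ (Fin d)) ∈ Metric.ball (0 : EuclideanSpace ℝ (Fin d)) r :=
  Metric.mem_ball_self h.pos

theorem map_mem (h : IsGraphChart M x ι ψ r U) {s : EuclideanSpace ℝ (Fin d)}
    (hs : s ∈ Metric.ball 0 r) : ψ s ∈ U ∩ M :=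
  h.image_ball ▸ mem_image_of_mem ψ hs

theorem mem (h : IsGraphChart M x ι ψ r U) : x ∈ U ∩ M := by
  have := h.map_mem h.zero_mem
  rwa [h.map_zero] at this

theorem right_inv (h : IsGraphChart M x ι ψ r U) {y : EuclideanSpace ℝ (Fin n)}
    (hy : y ∈ U ∩ M) : ContinuousLinearMap.adjoint ι.toContinuousLinearMap (y - x) ∈
      Metric.ball 0 r ∧ ψ (ContinuousLinearMap.adjoint ι.toContinuousLinearMap (y - x)) = y := by
  rw [← h.image_ball] at hy
  obtain ⟨s, hs, rfl⟩ := hy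
  rw [h.adjoint_sub s hs]
  exact ⟨hs, rfl⟩

theorem shrink (h : IsGraphChart M x ι ψ r U) {r' : ℝ} (hr' : 0 < r') (hle : r' ≤ r) :
    ∃ U', IsGraphChart M x ι ψ r' U' := by
  have hsub : Metric.ball (0 : EuclideanSpace ℝ (Fin d)) r' ⊆ Metric.ball 0 r :=
    Metric.ball_subset_ball hle
  obtain ⟨V, φ, g, h1, h2, h3, h4⟩ := h.factors
  refine ⟨U ∩ (fun y => ContinuousLinearMap.adjoint ι.toContinuousLinearMap (y - x)) ⁻¹'
    Metric.ball 0 r', hr', h.isOpen.inter (Metric.isOpen_ball.preimage (by fun_prop)), ?_,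
    h.map_zero, h.continuousOn.mono hsub, h.hasFDerivAt, fun s hs => h.adjoint_sub s (hsub hs),
    V, φ, g, h1, h2, h3.mono_left hsub, h4.mono hsub⟩
  ext y
  constructor
  · rintro ⟨s, hs, rfl⟩
    refine ⟨⟨(h.map_mem (hsub hs)).1, ?_⟩, (h.map_mem (hsub hs)).2⟩
    rw [mem_preimage, h.adjoint_sub s (hsub hs)]
    exact hs
  · rintro ⟨⟨hyU, hy⟩, hyM⟩
    exact ⟨_, hy, (h.right_inv ⟨hyU, hyM⟩).2⟩

/-- Smoothness on `M` is tested only on local parametrizations, so the factorization of `ψ` through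
one of them is what transfers it to the graph chart. -/
theorem contDiffAt_comp (h : IsGraphChart M x ι ψ r U) {F : Type*} [NormedAddCommGroup F]
    [NormedSpace ℝ F] {f : EuclideanSpace ℝ (Fin n) → F} (hf : SmoothOnSubmanifold d M f) :
    ContDiffAt ℝ ∞ (fun s => f (ψ s)) 0 := by
  obtain ⟨V, φ, g, h1, h2, h3, h4⟩ := h.factors
  have h5 : ContDiffAt ℝ ∞ (fun s => f (φ (g s))) 0 :=
    ContDiffAt.comp (f := g) (0 : EuclideanSpace ℝ (Fin d))
      ((hf V φ h1).contDiffAt (h1.isOpen.mem_nhds (h3 h.zero_mem))) h2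
  refine h5.congr_of_eventuallyEq ?_
  filter_upwards [Metric.ball_mem_nhds 0 h.pos] with s hs
  rw [h4 hs]; rfl

theorem contDiffAt (h : IsGraphChart M x ι ψ r U) : ContDiffAt ℝ ∞ ψ 0 :=
  h.contDiffAt_comp (f := id) fun _ _ hφ => hφ.smooth

theorem continuousWithinAt (h : IsGraphChart M x ι ψ r U) {F : Type*} [NormedAddCommGroup F]
    [NormedSpace ℝ F] {f : EuclideanSpace ℝ (Fin n) → F} (hf : SmoothOnSubmanifold d M f) :
    ContinuousWithinAt f M x := by
  set ρ := fun y => ContinuousLinearMap.adjoint ι.toContinuousLinearMap (y - x) with hρ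
  have h1 : ContinuousAt (fun s => f (ψ s)) (ρ x) := by
    simpa [hρ] using (h.contDiffAt_comp hf).continuousAt
  have h2 : ContinuousAt ρ x := by fun_prop
  have h3 : ContinuousAt (fun y => f (ψ (ρ y))) x :=
    ContinuousAt.comp (f := ρ) (g := fun s => f (ψ s)) h1 h2
  refine h3.continuousWithinAt.congr_of_eventuallyEq ?_ ?_
  · filter_upwards [self_mem_nhdsWithin, mem_nhdsWithin_of_mem_nhds (h.isOpen.mem_nhds h.mem.1)]
      with y hyM hyU
    exact congrArg f (h.right_inv ⟨hyU, hyM⟩).2.symm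
  · exact congrArg f (h.right_inv h.mem).2.symm

/-- A curve in `M` through `x` equals `ψ` composed with its own projection to the tangent space, so
by the chain rule its velocity lies in the range of `ι`. Conversely, images of lines under `ψ`
realize every vector of that range. -/
theorem embTangentSpace_eq (h : IsGraphChart M x ι ψ r U) :
    embTangentSpace M x = LinearMap.range ι.toLinearMap := by
  apply le_antisymm
  · refine Submodule.span_le.2 ?_
    rintro _ ⟨γ, hγ, hγ0, hγM, rfl⟩
    have h1 : HasDerivAt γ (deriv γ 0) 0 := (hγ.differentiableAt (by simp)).hasDerivAt
    set L := ContinuousLinearMap.adjoint ι.toContinuousLinearMap with hL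
    have h2 : HasDerivAt (fun s => L (γ s - x)) (L (deriv γ 0)) 0 :=
      L.hasFDerivAt.comp_hasDerivAt (0 : ℝ) (h1.sub_const x)
    have h3 : HasFDerivAt ψ ι.toContinuousLinearMap (L (γ 0 - x)) := by
      simpa [hγ0] using h.hasFDerivAt
    have h4 : HasDerivAt (ψ ∘ fun s => L (γ s - x))
        (ι.toContinuousLinearMap (L (deriv γ 0))) 0 :=
      h3.comp_hasDerivAt (0 : ℝ) h2
    have h5 : γ =ᶠ[𝓝 0] fun s => ψ (L (γ s - x)) := by
      have hU : ∀ᶠ s in 𝓝 (0 : ℝ), γ s ∈ U :=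
        hγ.continuousAt.eventually (by rw [hγ0]; exact h.isOpen.mem_nhds h.mem.1)
      filter_upwards [hγM, hU] with s hsM hsU
      exact (h.right_inv ⟨hsU, hsM⟩).2.symm
    have h6 := h1.unique (h4.congr_of_eventuallyEq h5)
    rw [h6]
    exact ⟨_, rfl⟩
  · rintro _ ⟨w, rfl⟩
    have := fderiv_apply_mem_embTangentSpace (M := M) h.contDiffAt
      (by filter_upwards [Metric.ball_mem_nhds 0 h.pos] with s hs using (h.map_mem hs).2) w
    rw [h.map_zero, h.hasFDerivAt.fderiv] at this
    exact this

end IsGraphChart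

theorem SmoothOnSubmanifold.continuousOn {M : Set (EuclideanSpace ℝ (Fin n))}
    (hM : IsSubmanifold d M) {F : Type*} [NormedAddCommGroup F]
    [NormedSpace ℝ F] {f : EuclideanSpace ℝ (Fin n) → F} (hf : SmoothOnSubmanifold d M f) :
    ContinuousOn f M := by
  intro x hx
  obtain ⟨ι, ψ, r, U, h⟩ := hM.exists_isGraphChart hx
  exact h.continuousWithinAt hf

theorem IsLocalParam.range_fderiv {M : Set (EuclideanSpace ℝ (Fin n))}
    {V : Set (EuclideanSpace ℝ (Fin d))}
    {φ : EuclideanSpace ℝ (Fin d) → EuclideanSpace ℝ (Fin n)} (h : IsLocalParam M V φ)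
    (hM : IsSubmanifold d M) {u : EuclideanSpace ℝ (Fin d)} (hu : u ∈ V) :
    LinearMap.range (fderiv ℝ φ u).toLinearMap = embTangentSpace M (φ u) := by
  obtain ⟨ι, ψ, r, U, hψ⟩ := hM.exists_isGraphChart (h.mem hu)
  refine Submodule.eq_of_le_of_finrank_eq ?_ ?_
  · rintro _ ⟨w, rfl⟩
    exact fderiv_apply_mem_embTangentSpace (h.contDiffAt hu)
      (by filter_upwards [h.isOpen.mem_nhds hu] with v hv using h.mem hv) w
  · rw [hψ.embTangentSpace_eq, LinearMap.finrank_range_of_inj (h.immersion u hu),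
      LinearMap.finrank_range_of_inj ι.injective]

end GraphChart

/-! ### The Riemannian volume in a graph chart -/

section GraphVolume

open scoped ENNReal NNReal

theorem LipschitzOnWith.euclideanHausdorffMeasure_image_le {X Y : Type*} [EMetricSpace X]
    [MeasurableSpace X] [BorelSpace X] [EMetricSpace Y] [MeasurableSpace Y] [BorelSpace Y]
    {K : ℝ≥0} {f : X → Y} {s : Set X} (h : LipschitzOnWith K f s) (d : ℕ) :
    Measure.euclideanHausdorffMeasure d (f '' s) ≤
      (K : ℝ≥0∞) ^ d * Measure.euclideanHausdorffMeasure d s := by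
  simp only [Measure.euclideanHausdorffMeasure_def, Measure.smul_apply, ENNReal.smul_def,
    smul_eq_mul]
  rw [mul_left_comm]
  gcongr
  simpa using h.hausdorffMeasure_image_le (d := d) (Nat.cast_nonneg d)

/-- Turns the factor `K ^ d` by which a `K`-Lipschitz map scales `d`-dimensional measure into `1 +
O(ρ²)` when `K = 1 + C ρ²`. -/
theorem exists_one_add_pow_le (d : ℕ) (u₀ : ℝ) :
    ∃ C : ℝ, 0 ≤ C ∧ ∀ u, 0 ≤ u → u ≤ u₀ → (1 + u) ^ d ≤ 1 + C * u := by
  induction d with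
  | zero => exact ⟨0, le_rfl, fun u _ _ => by simp⟩
  | succ d ih =>
    obtain ⟨C, hC, h⟩ := ih
    refine ⟨C + 1 + C * |u₀|, by positivity, fun u hu hu' => ?_⟩
    have h1 := h u hu hu'
    have h2 : u ≤ |u₀| := hu'.trans (le_abs_self _)
    have h3 : C * u * u ≤ C * |u₀| * u := by gcongr
    calc (1 + u) ^ (d + 1) = (1 + u) ^ d * (1 + u) := pow_succ _ _
      _ ≤ (1 + C * u) * (1 + u) := by gcongr
      _ ≤ _ := by nlinarith

variable {n d : ℕ} {M : Set (EuclideanSpace ℝ (Fin n))} {x : EuclideanSpace ℝ (Fin n)}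
    {ι : EuclideanSpace ℝ (Fin d) →ₗᵢ[ℝ] EuclideanSpace ℝ (Fin n)}
    {ψ : EuclideanSpace ℝ (Fin d) → EuclideanSpace ℝ (Fin n)} {r : ℝ}
    {U : Set (EuclideanSpace ℝ (Fin n))}

/-- Pythagoras: `ι s` is the orthogonal projection of `y` to the range of `ι`. -/
theorem LinearIsometry.norm_sq_eq_add_of_adjoint_eq {y : EuclideanSpace ℝ (Fin n)}
    {s : EuclideanSpace ℝ (Fin d)}
    (h : ContinuousLinearMap.adjoint ι.toContinuousLinearMap y = s) :
    ‖y‖ ^ 2 = ‖s‖ ^ 2 + ‖y - ι s‖ ^ 2 := by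
  have h1 : inner ℝ y (ι s) = inner ℝ s s := by
    conv_rhs => rw [← h]
    rw [ContinuousLinearMap.adjoint_inner_left, h]; rfl
  rw [norm_sub_sq_real, h1, ι.norm_map, real_inner_self_eq_norm_sq]
  ring

namespace IsGraphChart

theorem norm_sub_le (h : IsGraphChart M x ι ψ r U) {s s' : EuclideanSpace ℝ (Fin d)}
    (hs : s ∈ Metric.ball 0 r) (hs' : s' ∈ Metric.ball 0 r) : ‖s - s'‖ ≤ ‖ψ s - ψ s'‖ := by
  have h1 := ι.norm_adjoint_apply_le (ψ s - x - (ψ s' - x))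
  rwa [map_sub, h.adjoint_sub s hs, h.adjoint_sub s' hs', sub_sub_sub_cancel_right] at h1

/-- A graph chart is, on small balls, an isometry up to a quadratic error. -/
theorem exists_norm_sub_sq_le (h : IsGraphChart M x ι ψ r U) :
    ∃ C r' : ℝ, 0 ≤ C ∧ 0 < r' ∧ r' ≤ r ∧ ∀ ρ : ℝ, ∀ s ∈ Metric.ball 0 r', ∀ s' ∈ Metric.ball 0 r',
      ‖s‖ ≤ ρ → ‖s'‖ ≤ ρ → ‖ψ s - ψ s'‖ ^ 2 ≤ (1 + C * ρ ^ 2) * ‖s - s'‖ ^ 2 := by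
  set f : EuclideanSpace ℝ (Fin d) → EuclideanSpace ℝ (Fin n) := fun s => ψ s - ι s with hf
  have hψ : ContDiffAt ℝ 2 ψ 0 := h.contDiffAt.of_le (WithTop.coe_le_coe.2 le_top)
  have hfc : ContDiffAt ℝ 2 f 0 := hψ.sub ι.toContinuousLinearMap.contDiff.contDiffAt
  have hd : ∀ᶠ s in 𝓝 (0 : EuclideanSpace ℝ (Fin d)), DifferentiableAt ℝ f s :=
    (hfc.eventually (by simp)).mono fun s hs => hs.differentiableAt (by simp)
  have hf0 : fderiv ℝ f 0 = 0 := by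
    have := (h.hasFDerivAt.sub ι.toContinuousLinearMap.hasFDerivAt).fderiv
    rw [sub_self] at this
    exact this
  have hO : fderiv ℝ f =O[𝓝 0] fun s => ‖s‖ := by
    have := (hfc.fderiv_right (m := 1) (by norm_num)).isBigO_sub_zero
    simpa [hf0] using this
  obtain ⟨C, hC0, hC⟩ := hO.exists_nonneg
  obtain ⟨ε, hε, hball⟩ := Metric.eventually_nhds_iff_ball.1 (hd.and hC.bound)
  refine ⟨C ^ 2, min ε r, by positivity, lt_min hε h.pos, min_le_right _ _, ?_⟩
  intro ρ s hs s' hs' hsρ hsρ'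
  have hsub : Metric.ball (0 : EuclideanSpace ℝ (Fin d)) (min ε r) ⊆ Metric.ball 0 r :=
    Metric.ball_subset_ball (min_le_right _ _)
  have hsub' : Metric.ball (0 : EuclideanSpace ℝ (Fin d)) (min ε r) ⊆ Metric.ball 0 ε :=
    Metric.ball_subset_ball (min_le_left _ _)
  have h1 : ContinuousLinearMap.adjoint ι.toContinuousLinearMap (ψ s - ψ s') = s - s' := by
    rw [← sub_sub_sub_cancel_right (ψ s) (ψ s') x, map_sub, h.adjoint_sub s (hsub hs),
      h.adjoint_sub s' (hsub hs')]
  have hconv : Convex ℝ (Metric.ball (0 : EuclideanSpace ℝ (Fin d)) (min ε r) ∩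
      Metric.closedBall 0 ρ) := (convex_ball _ _).inter (convex_closedBall _ _)
  -- The normal deviation `f = ψ - ι` has derivative `O(‖s‖)`, so it is `C ρ`-Lipschitz at radius
  -- `ρ`. Pythagoras squares this constant, which makes the distortion quadratic in `ρ`.
  have h2 : ‖f s - f s'‖ ≤ C * ρ * ‖s - s'‖ := by
    refine hconv.norm_image_sub_le_of_norm_fderiv_le (𝕜 := ℝ)
      (fun z hz => (hball z (hsub' hz.1)).1) (fun z hz => ?_) ⟨hs', by simpa using hsρ'⟩
      ⟨hs, by simpa using hsρ⟩
    have h3 := (hball z (hsub' hz.1)).2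
    have h4 : ‖z‖ ≤ ρ := by simpa using hz.2
    rw [norm_norm] at h3
    exact h3.trans (by gcongr)
  have h3 : ψ s - ψ s' - ι (s - s') = f s - f s' := by
    simp only [hf, map_sub]; abel
  rw [LinearIsometry.norm_sq_eq_add_of_adjoint_eq h1, h3]
  have h4 : ‖f s - f s'‖ ^ 2 ≤ (C * ρ * ‖s - s'‖) ^ 2 := by gcongr
  nlinarith

/-- The pullback of the volume of `M` by a graph chart has a density with respect to Lebesgue
measure, which equals `1` up to a quadratic error. -/
theorem exists_volume_density (h : IsGraphChart M x ι ψ r U) (hM : MeasurableSet M) {C : ℝ}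
    (hC : 0 ≤ C) (hlip : ∀ ρ : ℝ, ∀ s ∈ Metric.ball 0 r, ∀ s' ∈ Metric.ball 0 r,
      ‖s‖ ≤ ρ → ‖s'‖ ≤ ρ → ‖ψ s - ψ s'‖ ^ 2 ≤ (1 + C * ρ ^ 2) * ‖s - s'‖ ^ 2) :
    riemVolume d M (U ∩ M) < ⊤ ∧
    ∃ (J : EuclideanSpace ℝ (Fin d) → ℝ) (C' : ℝ), 0 ≤ C' ∧ Measurable J ∧
      (∀ᵐ s ∂(volume.restrict (Metric.ball 0 r)), |J s - 1| ≤ C' * ‖s‖ ^ 2) ∧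
      ∀ {G : Type} [NormedAddCommGroup G] [NormedSpace ℝ G]
        {Φ : EuclideanSpace ℝ (Fin n) → G}, ContinuousOn Φ M →
        ∫ y in U ∩ M, Φ y ∂(riemVolume d M) = ∫ s in Metric.ball 0 r, J s • Φ (ψ s) := by
  set B := Metric.ball (0 : EuclideanSpace ℝ (Fin d)) r with hB
  set L : EuclideanSpace ℝ (Fin n) → EuclideanSpace ℝ (Fin d) :=
    fun y => ContinuousLinearMap.adjoint ι.toContinuousLinearMap (y - x) with hL
  have hLc : Continuous L := by fun_prop
  have hLψ : ∀ s ∈ B, L (ψ s) = s := h.adjoint_sub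
  set μ : Measure (EuclideanSpace ℝ (Fin n)) := Measure.euclideanHausdorffMeasure d with hμ
  have hUM : MeasurableSet (U ∩ M) := h.isOpen.measurableSet.inter hM
  have hres : (riemVolume d M).restrict (U ∩ M) = μ.restrict (U ∩ M) :=
    Measure.restrict_restrict_of_subset inter_subset_right
  -- No area formula is needed: `ν` is the volume of `M` projected to the tangent space, and its
  -- Radon–Nikodym derivative is squeezed between Lipschitz bounds. The lower bound holds because
  -- `L` is a contraction, the upper one because `ψ` is nearly isometric on small balls.
  set ν : Measure (EuclideanSpace ℝ (Fin d)) := (μ.restrict (U ∩ M)).map L with hν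
  have hνE : ∀ E, MeasurableSet E → ν E = μ (ψ '' (E ∩ B)) := by
    intro E hE
    rw [hν, Measure.map_apply hLc.measurable hE, Measure.restrict_apply (hLc.measurable hE)]
    congr 1
    ext y
    constructor
    · rintro ⟨hyE, hyU⟩
      exact ⟨L y, ⟨hyE, (h.right_inv hyU).1⟩, (h.right_inv hyU).2⟩
    · rintro ⟨s, ⟨hsE, hsB⟩, rfl⟩
      refine ⟨?_, h.map_mem hsB⟩
      rw [mem_preimage, hLψ s hsB]; exact hsE
  have hvol : ∀ E : Set (EuclideanSpace ℝ (Fin d)),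
      Measure.euclideanHausdorffMeasure d E = volume E := fun E => by
    rw [EuclideanSpace.euclideanHausdorffMeasure_eq_volume]
  obtain ⟨C₁, hC₁, hpow⟩ := exists_one_add_pow_le d (C * r ^ 2)
  have hlow : ∀ E, E ⊆ B → volume E ≤ μ (ψ '' E) := by
    intro E hE
    have h1 : LipschitzOnWith 1 L (ψ '' E) := by
      refine LipschitzOnWith.of_dist_le_mul fun y _ y' _ => ?_
      rw [dist_eq_norm, dist_eq_norm, hL, ← map_sub, sub_sub_sub_cancel_right]
      simpa using ι.norm_adjoint_apply_le (y - y')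
    have h2 := h1.euclideanHausdorffMeasure_image_le d
    have h3 : L '' (ψ '' E) = E := by
      rw [← image_comp]
      exact (EqOn.image_eq (f₂ := id) fun s hs => hLψ s (hE hs)).trans (image_id _)
    rw [h3, hvol] at h2
    simpa using h2
  have hup : ∀ ρ : ℝ, 0 ≤ ρ → ρ ≤ r → ∀ E, E ⊆ B → E ⊆ Metric.closedBall 0 ρ →
      μ (ψ '' E) ≤ ENNReal.ofReal (1 + C₁ * (C * ρ ^ 2)) * volume E := by
    intro ρ hρ hρr E hEB hEρ
    have h1 : LipschitzOnWith (Real.toNNReal (1 + C * ρ ^ 2)) ψ E := by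
      refine LipschitzOnWith.of_dist_le_mul fun s hs s' hs' => ?_
      rw [dist_eq_norm, dist_eq_norm, Real.coe_toNNReal _ (by positivity)]
      have h2 := hlip ρ s (hEB hs) s' (hEB hs') (by simpa using hEρ hs) (by simpa using hEρ hs')
      refine le_of_sq_le_sq (h2.trans ?_) (by positivity)
      rw [mul_pow]
      gcongr
      have : 0 ≤ C * ρ ^ 2 := by positivity
      nlinarith
    refine (h1.euclideanHausdorffMeasure_image_le d).trans ?_
    rw [hvol]
    gcongr
    rw [← ENNReal.ofReal, ← ENNReal.ofReal_pow (by positivity)]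
    exact ENNReal.ofReal_le_ofReal (hpow _ (by positivity) (by gcongr))
  have hBfin : volume B < ⊤ := measure_ball_lt_top
  have hBr : B ⊆ Metric.closedBall 0 r := Metric.ball_subset_closedBall
  have hfin : μ (U ∩ M) < ⊤ := by
    rw [← h.image_ball]
    exact (hup r h.pos.le le_rfl B Subset.rfl hBr).trans_lt
      (ENNReal.mul_lt_top ENNReal.ofReal_lt_top hBfin)
  have hfin' : riemVolume d M (U ∩ M) < ⊤ := by
    rw [riemVolume, Measure.restrict_apply hUM, inter_assoc, inter_self]
    exact hfin
  have : IsFiniteMeasure (μ.restrict (U ∩ M)) := ⟨by rwa [Measure.restrict_apply_univ]⟩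
  have : IsFiniteMeasure ν := by rw [hν]; infer_instance
  set volB : Measure (EuclideanSpace ℝ (Fin d)) := volume.restrict B with hvolB
  have hac : ν ≪ volB := by
    refine Measure.AbsolutelyContinuous.mk fun E hE hE0 => ?_
    rw [hvolB, Measure.restrict_apply hE] at hE0
    rw [hνE E hE]
    refine le_antisymm ((hup r h.pos.le le_rfl _ inter_subset_right
      (inter_subset_right.trans hBr)).trans ?_) bot_le
    simp [hE0]
  have hdens : volB.withDensity (ν.rnDeriv volB) = ν := Measure.withDensity_rnDeriv_eq ν volB hac
  have hint : ∀ E, MeasurableSet E → ∫⁻ s in E, ν.rnDeriv volB s ∂volB = ν E := by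
    intro E hE
    rw [← withDensity_apply _ hE, hdens]
  have hJm : Measurable (ν.rnDeriv volB) := Measure.measurable_rnDeriv _ _
  have hge : ∀ᵐ s ∂volB, 1 ≤ ν.rnDeriv volB s := by
    refine ae_le_of_forall_setLIntegral_le_of_sigmaFinite (f := fun _ => 1) measurable_const
      fun E hE _ => ?_
    rw [hint E hE, hνE E hE, setLIntegral_one, hvolB, Measure.restrict_apply hE]
    exact hlow _ inter_subset_right
  -- Rational radii keep the union of exceptional null sets null.
  have hle : ∀ᵐ s ∂volB, ∀ ρ : ℚ, 0 ≤ ρ → (ρ : ℝ) ≤ r → ‖s‖ ≤ ρ →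
      ν.rnDeriv volB s ≤ ENNReal.ofReal (1 + C₁ * (C * (ρ : ℝ) ^ 2)) := by
    rw [ae_all_iff]
    intro ρ
    by_cases hρ : 0 ≤ ρ ∧ (ρ : ℝ) ≤ r
    · have hρ0 : (0 : ℝ) ≤ ρ := by exact_mod_cast hρ.1
      have h1 : ∀ᵐ s ∂(volB.restrict (Metric.closedBall 0 (ρ : ℝ))),
          ν.rnDeriv volB s ≤ ENNReal.ofReal (1 + C₁ * (C * (ρ : ℝ) ^ 2)) := by
        refine ae_le_of_forall_setLIntegral_le_of_sigmaFinite hJm fun E hE _ => ?_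
        rw [Measure.restrict_restrict hE, hint _ (hE.inter Metric.isClosed_closedBall.measurableSet),
          hνE _ (hE.inter Metric.isClosed_closedBall.measurableSet), setLIntegral_const, hvolB,
          Measure.restrict_apply (hE.inter Metric.isClosed_closedBall.measurableSet)]
        exact hup ρ hρ0 hρ.2 _ inter_subset_right (inter_subset_left.trans inter_subset_right)
      rw [ae_restrict_iff' Metric.isClosed_closedBall.measurableSet] at h1
      filter_upwards [h1] with s hs _ _ hsρ
      exact hs (by simpa using hsρ)
    · exact Eventually.of_forall fun s h1 h2 => absurd ⟨h1, h2⟩ hρ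
  refine ⟨hfin', fun s => (ν.rnDeriv volB s).toReal, 4 * (C₁ * C), by positivity,
    hJm.ennreal_toReal, ?_, ?_⟩
  · filter_upwards [hge, hle, ae_restrict_mem Metric.isOpen_ball.measurableSet] with s h1 h2 hsB
    have hsr : ‖s‖ < r := by simpa [hB] using hsB
    -- A rational radius between `‖s‖` and `2 ‖s‖`; squaring the `2` gives the `4` in the constant.
    obtain ⟨ρ, hρ0, hρr, hsρ, hρs⟩ : ∃ ρ : ℚ, 0 ≤ ρ ∧ (ρ : ℝ) ≤ r ∧ ‖s‖ ≤ ρ ∧ (ρ : ℝ) ≤ 2 * ‖s‖ := by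
      rcases (norm_nonneg s).eq_or_lt with h0 | h0
      · exact ⟨0, le_rfl, by simpa using h.pos.le, by simp [← h0], by simp [← h0]⟩
      · obtain ⟨ρ, hρ1, hρ2⟩ := exists_rat_btwn (show ‖s‖ < min r (2 * ‖s‖) from
          lt_min hsr (by linarith))
        have : (0 : ℝ) < ρ := h0.trans hρ1
        exact ⟨ρ, by exact_mod_cast this.le, (hρ2.trans_le (min_le_left _ _)).le, hρ1.le,
          (hρ2.trans_le (min_le_right _ _)).le⟩
    have h3 := h2 ρ hρ0 hρr hsρ
    have hρ0' : (0 : ℝ) ≤ ρ := by exact_mod_cast hρ0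
    have h4 : (ν.rnDeriv volB s).toReal ≤ 1 + C₁ * (C * (ρ : ℝ) ^ 2) :=
      ENNReal.toReal_le_of_le_ofReal (by positivity) h3
    have h5 : 1 ≤ (ν.rnDeriv volB s).toReal := by
      have := ENNReal.toReal_mono (h3.trans_lt ENNReal.ofReal_lt_top).ne h1
      simpa using this
    rw [abs_of_nonneg (by linarith)]
    have h6 : C₁ * (C * (ρ : ℝ) ^ 2) ≤ C₁ * (C * (2 * ‖s‖) ^ 2) := by gcongr
    linarith
  · intro G _ _ Φ hΦ
    have hψm : AEStronglyMeasurable (fun s => Φ (ψ s)) volB := by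
      refine ContinuousOn.aestronglyMeasurable ?_ Metric.isOpen_ball.measurableSet
      exact hΦ.comp h.continuousOn fun s hs => (h.map_mem hs).2
    have hψν : AEStronglyMeasurable (fun s => Φ (ψ s)) ν := hψm.mono_ac hac
    have e1 : ∫ y in U ∩ M, Φ y ∂μ = ∫ y in U ∩ M, Φ (ψ (L y)) ∂μ :=
      setIntegral_congr_fun hUM fun y hy => congrArg Φ (h.right_inv hy).2.symm
    have e2 : ∫ s, Φ (ψ s) ∂ν = ∫ y in U ∩ M, Φ (ψ (L y)) ∂μ :=
      integral_map hLc.aemeasurable hψν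
    rw [hres, e1, ← e2]
    conv_lhs => rw [← hdens]
    exact integral_withDensity_eq_integral_toReal_smul hJm (Measure.rnDeriv_lt_top ν volB) _

end IsGraphChart

theorem IsSubmanifold.riemVolume_lt_top (hM : IsSubmanifold d M) (hMc : IsCompact M) :
    riemVolume d M univ < ⊤ := by
  have hMm : MeasurableSet M := hMc.measurableSet
  rw [riemVolume, Measure.restrict_apply_univ]
  refine hMc.measure_lt_top_of_nhdsWithin fun y hy => ?_
  obtain ⟨ι, ψ, r, U, h⟩ := hM.exists_isGraphChart hy
  obtain ⟨C, r', hC, hr', hle, hlip⟩ := h.exists_norm_sub_sq_le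
  obtain ⟨U', h'⟩ := h.shrink hr' hle
  refine ⟨U' ∩ M, ?_, ?_⟩
  · rw [inter_comm]; exact inter_mem_nhdsWithin _ (h'.isOpen.mem_nhds h'.mem.1)
  · have := (h'.exists_volume_density hMm hC hlip).1
    rwa [riemVolume, Measure.restrict_apply (h'.isOpen.measurableSet.inter hMm), inter_assoc,
      inter_self] at this

end GraphVolume

/-! ### The exterior derivative in a graph chart -/

section ExteriorDerivative

variable {n d k : ℕ} {M : Set (EuclideanSpace ℝ (Fin n))} {x : EuclideanSpace ℝ (Fin n)}
    {W : EuclideanSpace ℝ (Fin n) → KArray n k}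

/-- Every tangent vector is the image of a coordinate vector, and an array in a tensor power of `T_x
M` is determined by its pairings with tangent vectors. This identifies the array chosen in
`exteriorDeriv` with any explicit candidate. -/
theorem IsExteriorDerivAt.unique (hM : IsSubmanifold d M) (hx : x ∈ M) {B B' : KArray n (k + 1)}
    (hB : IsExteriorDerivAt d M W x B) (hB' : IsExteriorDerivAt d M W x B') : B = B' := by
  refine eq_of_inner_pureTensor_eq hB.1 hB'.1 fun v hv => ?_
  obtain ⟨V, φ, hφ, u, hu, rfl⟩ := hM x hx
  have h1 : ∀ j, ∃ w, fderiv ℝ φ u w = v j := fun j => by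
    have := hv j
    rw [← hφ.range_fderiv hM hu] at this
    exact this
  choose w hw using h1
  have h2 := (hB.2 V φ hφ u hu rfl).trans (hB'.2 V φ hφ u hu rfl).symm
  have h3 := congrArg (fun T => T w) h2
  simp only [ContinuousAlternatingMap.compContinuousLinearMap_apply] at h3
  rw [arrayForm_apply _ hB.1.2, arrayForm_apply _ hB'.1.2] at h3
  have h4 : ⇑(fderiv ℝ φ u) ∘ w = v := funext hw
  rwa [h4] at h3

theorem IsExteriorDerivAt.exteriorDeriv_eq (hM : IsSubmanifold d M) (hx : x ∈ M)
    {B : KArray n (k + 1)} (hB : IsExteriorDerivAt d M W x B) :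
    exteriorDeriv d M W x = B := by
  have h : ∃ B, IsExteriorDerivAt d M W x B := ⟨B, hB⟩
  rw [exteriorDeriv, dif_pos h]
  exact h.choose_spec.unique hM hx hB

theorem ContinuousLinearMap.hasFDerivAt_apply_sub {E F : Type*} [NormedAddCommGroup E]
    [NormedSpace ℝ E] [NormedAddCommGroup F] [NormedSpace ℝ F] (L : E →L[ℝ] F) (x y : E) :
    HasFDerivAt (fun y => L (y - x)) L y := by
  simpa only [map_sub] using L.hasFDerivAt.sub_const (L x)

/-- Composing with the projection to `S` does not change `f` near `u`, so the derivative is fixed by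
the projection. -/
theorem fderiv_apply_mem_of_eventually_mem {E F : Type*} [NormedAddCommGroup E] [NormedSpace ℝ E]
    [NormedAddCommGroup F] [InnerProductSpace ℝ F] {S : Submodule ℝ F} [S.HasOrthogonalProjection]
    {f : E → F} {u : E} (hf : DifferentiableAt ℝ f u) (h : ∀ᶠ v in 𝓝 u, f v ∈ S) (w : E) :
    fderiv ℝ f u w ∈ S := by
  have h1 : HasFDerivAt (fun v => S.starProjection (f v)) (S.starProjection.comp (fderiv ℝ f u)) u :=
    S.starProjection.hasFDerivAt.comp u hf.hasFDerivAt
  have h2 : (fun v => S.starProjection (f v)) =ᶠ[𝓝 u] f :=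
    h.mono fun v hv => Submodule.starProjection_eq_self_iff.2 hv
  have h3 := h1.unique (hf.hasFDerivAt.congr_of_eventuallyEq h2)
  rw [← h3]
  exact Submodule.starProjection_apply_mem _ _

variable {ι : EuclideanSpace ℝ (Fin d) →ₗᵢ[ℝ] EuclideanSpace ℝ (Fin n)}
    {ψ : EuclideanSpace ℝ (Fin d) → EuclideanSpace ℝ (Fin n)} {r : ℝ}
    {U : Set (EuclideanSpace ℝ (Fin n))}

theorem sum_inner_mul_apply_eq (ι : EuclideanSpace ℝ (Fin d) →ₗᵢ[ℝ] EuclideanSpace ℝ (Fin n))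
    (f : EuclideanSpace ℝ (Fin d) →L[ℝ] ℝ) (z : EuclideanSpace ℝ (Fin d)) :
    ∑ i, inner ℝ (ι (EuclideanSpace.single i 1)) (ι z) * f (EuclideanSpace.single i 1) = f z := by
  have hz : z = ∑ i, z i • EuclideanSpace.single i (1 : ℝ) := by
    ext j
    simp [Finset.sum_apply, Pi.single_apply]
  conv_rhs => rw [hz]
  simp only [map_sum, map_smul, smul_eq_mul, ι.inner_map_map, EuclideanSpace.inner_single_left]
  simp

/-- The exterior derivative at `x`, computed in a graph chart. -/
theorem IsGraphChart.isExteriorDerivAt (h : IsGraphChart M x ι ψ r U)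
    (hW : IsDifferentialArray d M W) :
    IsExteriorDerivAt d M W x (∑ i, (alternatingArrays (embTangentSpace M x) (k + 1)).starProjection
      (vecWedge (ι (EuclideanSpace.single i 1))
        (fderiv ℝ (fun s => W (ψ s)) 0 (EuclideanSpace.single i 1)))) := by
  set D := ∑ i, (alternatingArrays (embTangentSpace M x) (k + 1)).starProjection
      (vecWedge (ι (EuclideanSpace.single i 1))
        (fderiv ℝ (fun s => W (ψ s)) 0 (EuclideanSpace.single i 1))) with hD
  have hDmem : D ∈ alternatingArrays (embTangentSpace M x) (k + 1) :=
    Submodule.sum_mem _ fun i _ => Submodule.starProjection_apply_mem _ _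
  refine ⟨hDmem, fun V φ hφ u hu hux => ?_⟩
  set dG := fderiv ℝ (fun s => W (ψ s)) 0 with hdG
  have hGdiff : DifferentiableAt ℝ (fun s => W (ψ s)) 0 :=
    (h.contDiffAt_comp hW.smooth).differentiableAt (by simp)
  -- Only antisymmetry passes to the derivative: the tangent spaces vary with the base point, so `dG
  -- s` may have normal components. Pairing with tangent vectors ignores them.
  have hanti : ∀ s, dG s ∈ antisymmetricArrays n k :=
    fderiv_apply_mem_of_eventually_mem hGdiff (by
      filter_upwards [Metric.ball_mem_nhds 0 h.pos] with s hs
      exact (hW.mem _ (h.map_mem hs).2).2)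
  set L := ContinuousLinearMap.adjoint ι.toContinuousLinearMap with hL
  -- Extend the form to a neighbourhood of `x` in `ℝⁿ`, constant along the fibres of `L`. Near `u`
  -- its pullback by `φ` is `coordForm φ W`, so naturality of `extDeriv` reduces every
  -- parametrization to one computation at `x`.
  set Ω : EuclideanSpace ℝ (Fin n) → EuclideanSpace ℝ (Fin n) [⋀^Fin k]→L[ℝ] ℝ :=
    fun y => arrayFormL n k (W (ψ (L (y - x)))) with hΩ
  have hΩd : HasFDerivAt Ω ((arrayFormL n k).comp (dG.comp L)) x := by
    have h1 : HasFDerivAt (fun y => L (y - x)) L x := L.hasFDerivAt_apply_sub x x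
    have h2 : HasFDerivAt (fun s => W (ψ s)) dG (L (x - x)) := by
      rw [sub_self, L.map_zero]; exact hGdiff.hasFDerivAt
    exact (arrayFormL n k).hasFDerivAt.comp x (HasFDerivAt.comp (f := fun y => L (y - x)) x h2 h1)
  have hcongr : coordForm φ W =ᶠ[𝓝 u]
      fun v => (Ω (φ v)).compContinuousLinearMap (fderiv ℝ φ v) := by
    have hU : ∀ᶠ v in 𝓝 u, φ v ∈ U :=
      (hφ.contDiffAt hu).continuousAt.eventually
        (by rw [hux]; exact h.isOpen.mem_nhds h.mem.1)
    filter_upwards [hU, hφ.isOpen.mem_nhds hu] with v hvU hvV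
    simp only [hΩ, coordForm, arrayFormL_apply]
    rw [(h.right_inv ⟨hvU, hφ.mem hvV⟩).2]
  rw [hcongr.extDeriv_eq, extDeriv_pullback (by rw [hux]; exact hΩd.differentiableAt)
    (hφ.contDiffAt hu) (by rw [minSmoothness_of_isRCLikeNormedField]; exact ENat.LEInfty.out), hux]
  ext w
  simp only [ContinuousAlternatingMap.compContinuousLinearMap_apply]
  have hv : ∀ j, (⇑(fderiv ℝ φ u) ∘ w) j ∈ embTangentSpace M x := fun j => by
    have := fderiv_apply_mem_embTangentSpace (M := M) (hφ.contDiffAt hu)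
      (by filter_upwards [hφ.isOpen.mem_nhds hu] with v hv using hφ.mem hv) (w j)
    rwa [hux] at this
  generalize ⇑(fderiv ℝ φ u) ∘ w = v at hv
  have hz : ∀ j, ι (L (v j)) = v j := fun j => by
    have h1 := hv j
    rw [h.embTangentSpace_eq] at h1
    obtain ⟨z, hz⟩ := h1
    change ι z = v j at hz
    rw [← hz, hL, ι.adjoint_apply_self]
  have hrhs : extDeriv Ω x v = ∑ p : Fin (k + 1),
      (-1 : ℝ) ^ (p : ℕ) * inner ℝ (dG (L (v p))) (pureTensor (p.removeNth v)) := by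
    rw [extDeriv, hΩd.fderiv, ContinuousAlternatingMap.alternatizeUncurryFin_apply]
    refine Finset.sum_congr rfl fun p _ => ?_
    rw [← arrayForm_apply _ (hanti _), zsmul_eq_mul]
    push_cast
    rfl
  rw [hrhs, arrayForm_apply _ hDmem.2, hD, sum_inner]
  simp only [inner_starProjection_pureTensor (vecWedge_mem_antisymmetricArrays _ _) hv,
    inner_vecWedge_pureTensor _ (hanti _)]
  rw [Finset.sum_comm]
  refine Finset.sum_congr rfl fun p _ => ?_
  rw [← Finset.mul_sum]
  congr 1
  -- Expanding the tangent vector `v p` in the orthonormal frame `ι eᵢ` collapses the sum over `i`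
  -- to the derivative in direction `v p`.
  have := sum_inner_mul_apply_eq ι
    (((innerSL ℝ).flip (pureTensor (p.removeNth v))).comp dG) (L (v p))
  rw [hz p] at this
  exact this

end ExteriorDerivative

/-! ### Gaussian integrals on a submanifold -/

section GaussianSubmanifold

variable {n d : ℕ} {M : Set (EuclideanSpace ℝ (Fin n))} {x : EuclideanSpace ℝ (Fin n)}

theorem IsSubmanifold.integrable_riemVolume (hM : IsSubmanifold d M) (hMc : IsCompact M)
    {G : Type*} [NormedAddCommGroup G] {f : EuclideanSpace ℝ (Fin n) → G}
    (hf : ContinuousOn f M) : Integrable f (riemVolume d M) := by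
  have : IsFiniteMeasure (riemVolume d M) := ⟨hM.riemVolume_lt_top hMc⟩
  obtain ⟨K, hK⟩ := hMc.exists_bound_of_continuousOn hf
  refine Integrable.of_bound (hf.aestronglyMeasurable hMc.measurableSet) K ?_
  filter_upwards [ae_restrict_mem hMc.measurableSet] with y hy using hK y hy

/-- From `u ^ N / N! ≤ e^u` with `u = c² / (2 t²)`; this gives `t ^ (2 N)`, of which half is
discarded. -/
theorem exp_neg_div_sq_le {c t : ℝ} (hc : 0 < c) (ht : 0 < t) (ht1 : t ≤ 1) (N : ℕ) :
    Real.exp (-c ^ 2 / (2 * t ^ 2)) ≤ N.factorial * (2 / c ^ 2) ^ N * t ^ N := by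
  have hu : 0 < c ^ 2 / (2 * t ^ 2) := by positivity
  have h1 := Real.pow_div_factorial_le_exp _ hu.le N
  have h2 : Real.exp (-c ^ 2 / (2 * t ^ 2)) = (Real.exp (c ^ 2 / (2 * t ^ 2)))⁻¹ := by
    rw [← Real.exp_neg]; congr 1; ring
  rw [h2]
  calc (Real.exp (c ^ 2 / (2 * t ^ 2)))⁻¹ ≤ ((c ^ 2 / (2 * t ^ 2)) ^ N / N.factorial)⁻¹ :=
        inv_anti₀ (by positivity) h1
    _ = N.factorial * (2 / c ^ 2) ^ N * (t ^ N * t ^ N) := by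
        rw [inv_div, ← mul_pow, mul_assoc, ← mul_pow, div_eq_mul_inv, ← inv_pow]
        congr 2
        field_simp
    _ ≤ N.factorial * (2 / c ^ 2) ^ N * (t ^ N * 1) := by
        gcongr; exact pow_le_one₀ ht.le ht1
    _ = _ := by rw [mul_one]

variable {ι : EuclideanSpace ℝ (Fin d) →ₗᵢ[ℝ] EuclideanSpace ℝ (Fin n)}
    {ψ : EuclideanSpace ℝ (Fin d) → EuclideanSpace ℝ (Fin n)} {r : ℝ}
    {U : Set (EuclideanSpace ℝ (Fin n))}

/-- Points of `M` outside `U` stay at a fixed distance from `x`, and `M` has finite volume, so the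
Gaussian is uniformly smaller than any power of `t` there. -/
theorem IsGraphChart.norm_integral_gaussian_compl_isBigO (h : IsGraphChart M x ι ψ r U)
    (hM : IsSubmanifold d M) (hMc : IsCompact M) {G : Type*} [NormedAddCommGroup G]
    [NormedSpace ℝ G] {Φ : EuclideanSpace ℝ (Fin n) → G} (hΦ : ContinuousOn Φ M) (N : ℕ) :
    (fun t : ℝ => ∫ y in (U ∩ M)ᶜ, Real.exp (-‖y - x‖ ^ 2 / (2 * t ^ 2)) • Φ y ∂(riemVolume d M))
      =O[𝓝[>] 0] fun t => t ^ N := by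
  have : IsFiniteMeasure (riemVolume d M) := ⟨hM.riemVolume_lt_top hMc⟩
  obtain ⟨c, hc, hcU⟩ := Metric.isOpen_iff.1 h.isOpen x h.mem.1
  obtain ⟨K, hK⟩ := hMc.exists_bound_of_continuousOn hΦ
  have hK0 : 0 ≤ K := (norm_nonneg _).trans (hK x h.mem.2)
  have hUM : MeasurableSet (U ∩ M) := h.isOpen.measurableSet.inter hMc.measurableSet
  refine IsBigO.of_bound (N.factorial * (2 / c ^ 2) ^ N * K *
    (riemVolume d M).real (U ∩ M)ᶜ) ?_
  filter_upwards [Ioc_mem_nhdsGT (zero_lt_one (α := ℝ))] with t ht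
  have ht0 : 0 < t := ht.1
  have hb : ∀ᵐ y ∂((riemVolume d M).restrict (U ∩ M)ᶜ),
      ‖Real.exp (-‖y - x‖ ^ 2 / (2 * t ^ 2)) • Φ y‖ ≤
        N.factorial * (2 / c ^ 2) ^ N * t ^ N * K := by
    have hM' : ∀ᵐ y ∂(riemVolume d M), y ∈ M := ae_restrict_mem hMc.measurableSet
    filter_upwards [ae_restrict_of_ae hM', ae_restrict_mem hUM.compl] with y hyM hy
    have hyc : c ≤ ‖y - x‖ := by
      by_contra hlt
      exact hy ⟨hcU (by simpa [dist_eq_norm] using hlt), hyM⟩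
    rw [norm_smul, Real.norm_of_nonneg (Real.exp_pos _).le]
    gcongr
    · refine (Real.exp_le_exp.2 ?_).trans (exp_neg_div_sq_le hc ht0 ht.2 N)
      gcongr
    · exact hK y hyM
  have h1 := norm_setIntegral_le_of_norm_le_const_ae (measure_lt_top _ _) hb
  rw [Real.norm_of_nonneg (by positivity)]
  refine h1.trans (le_of_eq ?_)
  ring

/-- Gaussian integrals over a compact submanifold are, to leading order, Gaussian integrals over
the tangent space. -/
theorem IsGraphChart.integral_gaussian_sub_isBigO (h : IsGraphChart M x ι ψ r U)
    (hM : IsSubmanifold d M) (hMc : IsCompact M) {G : Type} [NormedAddCommGroup G]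
    [NormedSpace ℝ G] {Φ : EuclideanSpace ℝ (Fin n) → G} (hΦ : ContinuousOn Φ M)
    {Q : EuclideanSpace ℝ (Fin d) → G} (hQc : Continuous Q) {p : ℕ} {K : ℝ}
    (hQ : ∀ s, ‖Q s‖ ≤ K * ‖s‖ ^ p)
    (hF : (fun s => Φ (ψ s)) =O[𝓝 0] fun s => ‖s‖ ^ p)
    (hFQ : (fun s => Φ (ψ s) + Φ (ψ (-s)) - (2 : ℝ) • Q s) =O[𝓝 0] fun s => ‖s‖ ^ (p + 2)) :
    (fun t : ℝ => (∫ y, Real.exp (-‖y - x‖ ^ 2 / (2 * t ^ 2)) • Φ y ∂(riemVolume d M)) -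
      ∫ s, Real.exp (-‖s‖ ^ 2 / (2 * t ^ 2)) • Q s) =O[𝓝[>] 0] fun t => t ^ (d + p + 2) := by
  obtain ⟨C₁, r₁, hC₁, hr₁, hr₁r, hlip⟩ := h.exists_norm_sub_sq_le
  obtain ⟨C₂, hC₂⟩ := hF.bound
  obtain ⟨C₃, hC₃⟩ := hFQ.bound
  obtain ⟨ε, hε, hball⟩ := Metric.eventually_nhds_iff_ball.1 (hC₂.and hC₃)
  set r₂ := min r₁ ε with hr₂
  have hr₂0 : 0 < r₂ := lt_min hr₁ hε
  have hsub₁ : Metric.ball (0 : EuclideanSpace ℝ (Fin d)) r₂ ⊆ Metric.ball 0 r₁ :=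
    Metric.ball_subset_ball (min_le_left _ _)
  have hsub₂ : Metric.ball (0 : EuclideanSpace ℝ (Fin d)) r₂ ⊆ Metric.ball 0 ε :=
    Metric.ball_subset_ball (min_le_right _ _)
  have hlip₂ : ∀ ρ : ℝ, ∀ s ∈ Metric.ball 0 r₂, ∀ s' ∈ Metric.ball 0 r₂,
      ‖s‖ ≤ ρ → ‖s'‖ ≤ ρ → ‖ψ s - ψ s'‖ ^ 2 ≤ (1 + C₁ * ρ ^ 2) * ‖s - s'‖ ^ 2 :=
    fun ρ s hs s' hs' => hlip ρ s (hsub₁ hs) s' (hsub₁ hs')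
  obtain ⟨U', h'⟩ := h.shrink hr₂0 ((min_le_left _ _).trans hr₁r)
  obtain ⟨-, J, C₄, hC₄, hJm, hJ, hchange⟩ :=
    h'.exists_volume_density hMc.measurableSet hC₁ hlip₂
  set C := max (max |C₁| |C₂|) (max |C₃| (max |C₄| |K|)) with hC
  have hC0 : 0 ≤ C := (abs_nonneg C₁).trans (by simp [hC])
  have l₁ : C₁ ≤ C := (le_abs_self C₁).trans (by simp [hC])
  have l₂ : C₂ ≤ C := (le_abs_self C₂).trans (by simp [hC])
  have l₃ : C₃ ≤ C := (le_abs_self C₃).trans (by simp [hC])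
  have l₄ : C₄ ≤ C := (le_abs_self C₄).trans (by simp [hC])
  have l₅ : K ≤ C := (le_abs_self K).trans (by simp [hC])
  have hψm : ContinuousOn (fun s => ‖ψ s - x‖ ^ 2) (Metric.ball 0 r₂) :=
    ((h'.continuousOn.sub continuousOn_const).norm).pow 2
  have hFm : ContinuousOn (fun s => Φ (ψ s)) (Metric.ball 0 r₂) :=
    hΦ.comp h'.continuousOn fun s hs => (h'.map_mem hs).2
  obtain ⟨C', hC'⟩ := exists_norm_gaussian_ball_sub_le (F := fun s => Φ (ψ s)) (Q := Q) (J := J)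
    (φ := fun s => ‖ψ s - x‖ ^ 2) (p := p) hr₂0 hC0 hJm.aestronglyMeasurable
    (hψm.aestronglyMeasurable Metric.isOpen_ball.measurableSet)
    (hFm.aestronglyMeasurable Metric.isOpen_ball.measurableSet) hQc
    (hJ.mono fun s hs => hs.trans (by gcongr))
    (fun s hs => by
      have h1 := h'.norm_sub_le hs h'.zero_mem
      have h2 := hlip₂ ‖s‖ s hs 0 h'.zero_mem le_rfl (by simp)
      rw [h.map_zero, sub_zero] at h1 h2
      refine ⟨by gcongr, h2.trans ?_⟩
      have : C₁ * ‖s‖ ^ 4 ≤ C * ‖s‖ ^ 4 := by gcongr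
      nlinarith)
    (fun s hs => by
      have := (hball s (hsub₂ hs)).1
      rw [norm_pow, norm_norm] at this
      exact this.trans (by gcongr))
    (fun s hs => by
      have := (hball s (hsub₂ hs)).2
      rw [norm_pow, norm_norm] at this
      exact this.trans (by gcongr))
    (fun s => (hQ s).trans (by gcongr))
  have hUM : MeasurableSet (U' ∩ M) := h'.isOpen.measurableSet.inter hMc.measurableSet
  have hmain : (fun t : ℝ => (∫ s in Metric.ball 0 r₂,
      J s • Real.exp (-‖ψ s - x‖ ^ 2 / (2 * t ^ 2)) • Φ (ψ s)) -
      ∫ s, Real.exp (-‖s‖ ^ 2 / (2 * t ^ 2)) • Q s) =O[𝓝[>] 0] fun t => t ^ (d + p + 2) := by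
    refine IsBigO.of_bound C' ?_
    filter_upwards [self_mem_nhdsWithin] with t ht
    have ht0 : 0 < t := ht
    rw [Real.norm_of_nonneg (by positivity)]
    exact hC' t ht0
  refine (hmain.add (h'.norm_integral_gaussian_compl_isBigO hM hMc hΦ (d + p + 2))).congr_left
    fun t => ?_
  have hcont : ContinuousOn (fun y => Real.exp (-‖y - x‖ ^ 2 / (2 * t ^ 2)) • Φ y) M :=
    ContinuousOn.smul (by fun_prop) hΦ
  rw [← integral_add_compl hUM (hM.integrable_riemVolume hMc hcont), hchange hcont]
  abel

end GaussianSubmanifold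

/-! ### The expansion of the operator `P_t` -/

section Expansion

variable {n d k : ℕ} {M : Set (EuclideanSpace ℝ (Fin n))} {x : EuclideanSpace ℝ (Fin n)}
  {q : EuclideanSpace ℝ (Fin n) → ℝ} {W : EuclideanSpace ℝ (Fin n) → KArray n k}
  {ι : EuclideanSpace ℝ (Fin d) →ₗᵢ[ℝ] EuclideanSpace ℝ (Fin n)}
  {ψ : EuclideanSpace ℝ (Fin d) → EuclideanSpace ℝ (Fin n)} {r : ℝ}
  {U : Set (EuclideanSpace ℝ (Fin n))}

/-- The wedge product followed by the orthogonal projection onto the alternating arrays in `V`. -/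
noncomputable def projVecWedgeL (k : ℕ) (V : Submodule ℝ (EuclideanSpace ℝ (Fin n))) :
    EuclideanSpace ℝ (Fin n) →L[ℝ] KArray n k →L[ℝ] KArray n (k + 1) :=
  (ContinuousLinearMap.compL ℝ (KArray n k) (KArray n (k + 1)) (KArray n (k + 1))
    (alternatingArrays V (k + 1)).starProjection).comp (vecWedgeL n k)

theorem projVecWedgeL_apply (V : Submodule ℝ (EuclideanSpace ℝ (Fin n)))
    (v : EuclideanSpace ℝ (Fin n)) (A : KArray n k) :
    projVecWedgeL k V v A = (alternatingArrays V (k + 1)).starProjection (vecWedge v A) := rfl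

theorem ContinuousOn.smul_bilin_sub {E F G : Type*} [NormedAddCommGroup E] [NormedSpace ℝ E]
    [NormedAddCommGroup F] [NormedSpace ℝ F] [NormedAddCommGroup G] [NormedSpace ℝ G]
    {S : Set E} {q : E → ℝ} {W : E → F} (hq : ContinuousOn q S) (hW : ContinuousOn W S)
    (b : E →L[ℝ] F →L[ℝ] G) (x : E) :
    ContinuousOn (fun y => q y • b (y - x) (W y - W x)) S := by
  refine hq.smul ?_
  exact b.continuous₂.comp_continuousOn
    ((continuousOn_id.sub (continuousOn_const (c := x))).prodMk
      (hW.sub (continuousOn_const (c := W x))))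

/-- Moving the projection under the integral makes the numerator a Gaussian integral of a bilinear
expression, to which the general expansion applies. -/
theorem projDiffusionOp_eq (hM : IsSubmanifold d M) (hMc : IsCompact M)
    (hq : SmoothOnSubmanifold d M q) (hW : SmoothOnSubmanifold d M W) (t : ℝ) :
    projDiffusionOp d M q t W x = (kernelNormalization d M q t x)⁻¹ •
      ∫ y, Real.exp (-‖y - x‖ ^ 2 / (2 * t ^ 2)) •
        (q y • projVecWedgeL k (embTangentSpace M x) (y - x) (W y - W x)) ∂(riemVolume d M) := by
  have hqc := hq.continuousOn hM
  have hWc := hW.continuousOn hM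
  have hpt : ∀ y, q y • vecWedge (gaussKernel d M q t x y) (W y - W x) =
      (kernelNormalization d M q t x)⁻¹ • (Real.exp (-‖y - x‖ ^ 2 / (2 * t ^ 2)) •
        (q y • vecWedgeL n k (y - x) (W y - W x))) := by
    intro y
    rw [← vecWedgeL_apply, gaussKernel, map_smul, smul_apply, smul_smul, smul_smul, smul_smul]
    congr 1
    ring
  have hcont : ContinuousOn (fun y => Real.exp (-‖y - x‖ ^ 2 / (2 * t ^ 2)) •
      (q y • vecWedgeL n k (y - x) (W y - W x))) M := by
    have h2 : ContinuousOn (fun y => Real.exp (-‖y - x‖ ^ 2 / (2 * t ^ 2))) M := by fun_prop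
    exact h2.smul (hqc.smul_bilin_sub hWc (vecWedgeL n k) x)
  rw [projDiffusionOp, diffusionOp, integral_congr_ae (Eventually.of_forall hpt), integral_smul,
    map_smul, ← ContinuousLinearMap.integral_comp_comm _ (hM.integrable_riemVolume hMc hcont)]
  simp only [map_smul]
  rfl

theorem integral_exp_neg_half_norm_sq_pos :
    0 < ∫ s : EuclideanSpace ℝ (Fin d), Real.exp (-(1 / 2) * ‖s‖ ^ 2) :=
  integral_exp_pos (integrable_exp_neg_mul_norm_sq (by norm_num))

/-- The Gaussian expansion with `p = 0` and the constant `Q = q x`. -/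
theorem IsGraphChart.kernelNormalization_sub_isBigO (h : IsGraphChart M x ι ψ r U)
    (hM : IsSubmanifold d M) (hMc : IsCompact M) (hq : SmoothOnSubmanifold d M q) :
    (fun t : ℝ => kernelNormalization d M q t x -
      t ^ d * (q x * ∫ s : EuclideanSpace ℝ (Fin d), Real.exp (-(1 / 2) * ‖s‖ ^ 2)))
      =O[𝓝[>] 0] fun t => t ^ (d + 2) := by
  have hqψ := h.contDiffAt_comp hq
  have h1 := h.integral_gaussian_sub_isBigO hM hMc (hq.continuousOn hM) (Q := fun _ => q x)
    continuous_const (p := 0) (K := ‖q x‖) (fun s => by simp)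
    (by simpa using hqψ.continuousAt.isBigO_one ℝ)
    (by simpa [h.map_zero] using (hqψ.of_le ENat.LEInfty.out).isBigO_even_part)
  refine h1.congr' ?_ EventuallyEq.rfl
  filter_upwards [self_mem_nhdsWithin] with t ht
  have h2 : ∫ s : EuclideanSpace ℝ (Fin d), Real.exp (-‖s‖ ^ 2 / (2 * t ^ 2)) =
      t ^ d * ∫ s : EuclideanSpace ℝ (Fin d), Real.exp (-(1 / 2) * ‖s‖ ^ 2) := by
    simpa using integral_norm_pow_mul_gaussian_scaled (d := d) 0 ht
  simp only [smul_eq_mul, kernelNormalization]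
  rw [integral_mul_const, h2]
  ring

/-- The Gaussian expansion with `p = 2` and `Q s = q x • b (ι s) (dG s)`; the trace formula
evaluates the leading integral. -/
theorem IsGraphChart.numerator_sub_isBigO (h : IsGraphChart M x ι ψ r U)
    (hM : IsSubmanifold d M) (hMc : IsCompact M) (hq : SmoothOnSubmanifold d M q)
    {F G : Type} [NormedAddCommGroup F] [NormedSpace ℝ F] [NormedAddCommGroup G] [NormedSpace ℝ G]
    [CompleteSpace G] {W : EuclideanSpace ℝ (Fin n) → F} (hW : SmoothOnSubmanifold d M W)
    (b : EuclideanSpace ℝ (Fin n) →L[ℝ] F →L[ℝ] G) :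
    (fun t : ℝ => (∫ y, Real.exp (-‖y - x‖ ^ 2 / (2 * t ^ 2)) •
        (q y • b (y - x) (W y - W x)) ∂(riemVolume d M)) -
      (t ^ (d + 2) * (q x * ∫ s : EuclideanSpace ℝ (Fin d), Real.exp (-(1 / 2) * ‖s‖ ^ 2))) •
        ∑ i, b (ι (EuclideanSpace.single i 1))
          (fderiv ℝ (fun s => W (ψ s)) 0 (EuclideanSpace.single i 1)))
      =O[𝓝[>] 0] fun t => t ^ (d + 4) := by
  have hqψ := h.contDiffAt_comp hq
  have hWψ := h.contDiffAt_comp hW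
  set dG := fderiv ℝ (fun s => W (ψ s)) 0 with hdG
  set B : EuclideanSpace ℝ (Fin d) →L[ℝ] EuclideanSpace ℝ (Fin d) →L[ℝ] G :=
    q x • b.bilinearComp ι.toContinuousLinearMap dG with hB
  have hBapp : ∀ s s', B s s' = q x • b (ι s) (dG s') := fun s s' => rfl
  have hΦc : ContinuousOn (fun y => q y • b (y - x) (W y - W x)) M :=
    (hq.continuousOn hM).smul_bilin_sub (hW.continuousOn hM) b x
  have ha : ContDiffAt ℝ ∞ (fun s => ψ s - x) 0 := h.contDiffAt.sub contDiffAt_const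
  have hg : ContDiffAt ℝ ∞ (fun s => W (ψ s) - W x) 0 := hWψ.sub contDiffAt_const
  have hda : fderiv ℝ (fun s => ψ s - x) 0 = ι.toContinuousLinearMap :=
    (h.hasFDerivAt.sub_const x).fderiv
  have hdg : fderiv ℝ (fun s => W (ψ s) - W x) 0 = dG := fderiv_sub_const _
  have l1 : (1 : WithTop ℕ∞) ≤ ∞ := ENat.LEInfty.out
  have l3 : (3 : WithTop ℕ∞) ≤ ∞ := ENat.LEInfty.out
  have hF : (fun s => q (ψ s) • b (ψ s - x) (W (ψ s) - W x)) =O[𝓝 0] fun s => ‖s‖ ^ 2 := by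
    have h1 := (ha.of_le l1).isBigO_sub_zero
    have h2 := (hg.of_le l1).isBigO_sub_zero
    simp only [h.map_zero, sub_self, sub_zero] at h1 h2
    have h3 := (hqψ.continuousAt.isBigO_one ℝ).smul (b.isBigO_bilin h1 h2)
    simpa [sq] using h3
  have hFQ := isBigO_even_part_smul_bilin b (hqψ.of_le l3) (ha.of_le l3) (hg.of_le l3)
    (by simp [h.map_zero]) (by simp [h.map_zero])
  rw [hda, hdg, h.map_zero] at hFQ
  have h1 := h.integral_gaussian_sub_isBigO hM hMc hΦc (Q := fun s => B s s)
    (B.continuous₂.comp (continuous_id.prodMk continuous_id)) (p := 2) (K := ‖B‖)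
    (fun s => (B.le_opNorm₂ s s).trans (le_of_eq (by ring))) hF hFQ
  refine h1.congr' ?_ EventuallyEq.rfl
  filter_upwards [self_mem_nhdsWithin] with t ht
  have ht0 : 0 < t := ht
  have h2 : ∫ s, Real.exp (-‖s‖ ^ 2 / (2 * t ^ 2)) • B s s =
      (t ^ (d + 2) * (q x * ∫ s : EuclideanSpace ℝ (Fin d), Real.exp (-(1 / 2) * ‖s‖ ^ 2))) •
        ∑ i, b (ι (EuclideanSpace.single i 1)) (dG (EuclideanSpace.single i 1)) := by
    rw [integral_eq_pow_smul_integral_comp_smul ht0]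
    have h3 : ∀ z : EuclideanSpace ℝ (Fin d),
        Real.exp (-‖t • z‖ ^ 2 / (2 * t ^ 2)) • B (t • z) (t • z) =
          t ^ 2 • (Real.exp (-(1 / 2) * ‖z‖ ^ 2) • B z z) := by
      intro z
      rw [gaussian_smul_arg ht0, map_smul, map_smul, smul_apply, smul_smul, smul_smul, smul_smul]
      congr 1
      ring
    rw [integral_congr_ae (Eventually.of_forall h3), integral_smul, integral_gaussian_smul_bilin]
    simp only [hBapp, ← Finset.smul_sum, smul_smul]
    congr 1
    ring
  rw [h2]

/-- `P_t W (x)`, projected to the alternating arrays in the tangent space, is `t² d_k W (x)` up to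
an error of fourth order. -/
theorem projDiffusionOp_sub_isBigO (hMc : IsCompact M) (hM : IsSubmanifold d M)
    (hq : SmoothOnSubmanifold d M q) (hW : IsDifferentialArray d M W) (hx : x ∈ M)
    (hqx : 0 < q x) :
    IsExteriorDerivAt d M W x (exteriorDeriv d M W x) ∧
    (fun t : ℝ => projDiffusionOp d M q t W x - t ^ 2 • exteriorDeriv d M W x)
      =O[𝓝[>] 0] fun t => t ^ 4 := by
  obtain ⟨ι, ψ, r, U, h⟩ := hM.exists_isGraphChart hx
  have hD := h.isExteriorDerivAt hW
  rw [IsExteriorDerivAt.exteriorDeriv_eq hM hx hD]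
  refine ⟨hD, ?_⟩
  have hN := h.numerator_sub_isBigO hM hMc hq hW.smooth (projVecWedgeL k (embTangentSpace M x))
  have hδ := h.kernelNormalization_sub_isBigO hM hMc hq
  simp only [projVecWedgeL_apply] at hN
  generalize ∑ i, (alternatingArrays (embTangentSpace M x) (k + 1)).starProjection
      (vecWedge (ι (EuclideanSpace.single i 1))
        (fderiv ℝ (fun s => W (ψ s)) 0 (EuclideanSpace.single i 1))) = D at hN ⊢
  have hκ : 0 < q x * ∫ s : EuclideanSpace ℝ (Fin d), Real.exp (-(1 / 2) * ‖s‖ ^ 2) :=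
    mul_pos hqx integral_exp_neg_half_norm_sq_pos
  set κ := q x * ∫ s : EuclideanSpace ℝ (Fin d), Real.exp (-(1 / 2) * ‖s‖ ^ 2)
  simp only [projDiffusionOp_eq hM hMc hq hW.smooth, projVecWedgeL_apply]
  set N : ℝ → KArray n (k + 1) := fun t => ∫ y, Real.exp (-‖y - x‖ ^ 2 / (2 * t ^ 2)) •
    (q y • (alternatingArrays (embTangentSpace M x) (k + 1)).starProjection
      (vecWedge (y - x) (W y - W x))) ∂(riemVolume d M)
  set δ : ℝ → ℝ := fun t => kernelNormalization d M q t x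
  have hpos : ∀ᶠ t : ℝ in 𝓝[>] 0, 0 < t := self_mem_nhdsWithin
  have hid : Tendsto (fun t : ℝ => t) (𝓝[>] 0) (𝓝 0) := tendsto_nhdsWithin_of_tendsto_nhds tendsto_id
  have hδo : (fun t => δ t - t ^ d * κ) =o[𝓝[>] 0] fun t => t ^ d * κ := by
    have h1 : (fun t : ℝ => t ^ (d + 2)) =o[𝓝[>] 0] fun t => t ^ d * κ := by
      have h2 : (fun t : ℝ => t ^ 2) =o[𝓝[>] 0] fun _ => κ :=
        (isLittleO_const_iff hκ.ne').2 (by simpa using hid.pow 2)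
      simpa only [pow_add] using (isBigO_refl (fun t : ℝ => t ^ d) _).mul_isLittleO h2
    exact hδ.trans_isLittleO h1
  have hδ1 : (fun t : ℝ => t ^ d) =O[𝓝[>] 0] δ := by
    have h1 : (fun t : ℝ => t ^ d) =O[𝓝[>] 0] fun t => t ^ d * κ :=
      (isBigO_const_mul_self κ⁻¹ _ _).congr_left fun t => by field_simp
    exact h1.trans (IsEquivalent.isBigO_symm (u := δ) hδo)
  have hδ0 : ∀ᶠ t in 𝓝[>] 0, δ t ≠ 0 := by
    filter_upwards [hδ1.eq_zero_imp, hpos] with t h1 h2 h3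
    exact (pow_pos h2 d).ne' (h1 h3)
  have hδinv : (fun t => (δ t)⁻¹) =O[𝓝[>] 0] fun t : ℝ => (t ^ d)⁻¹ :=
    hδ1.inv_rev (hpos.mono fun t ht h0 => absurd h0 (pow_pos ht d).ne')
  -- Comparing with `t² δ(t) D` rather than `t^(d+2) κ D` makes the main term exactly `t² D` after
  -- division by `δ(t)`, which is of order `t ^ d`.
  have hR : (fun t => N t - (t ^ 2 * δ t) • D) =O[𝓝[>] 0] fun t => t ^ (d + 4) := by
    have h1 : (fun t : ℝ => (t ^ 2 * (δ t - t ^ d * κ)) • D) =O[𝓝[>] 0] fun t => t ^ (d + 4) := by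
      have h2 := ((isBigO_refl (fun t : ℝ => t ^ 2) (𝓝[>] 0)).mul hδ).smul
        (isBigO_refl (fun _ => D) (𝓝[>] (0 : ℝ)))
      refine h2.trans ?_
      refine IsBigO.of_bound ‖D‖ (Eventually.of_forall fun t => le_of_eq ?_)
      rw [norm_smul, mul_comm]
      congr 2
      ring
    refine (hN.sub h1).congr_left fun t => ?_
    module
  refine ((hδinv.smul hR).congr' ?_ ?_)
  · filter_upwards [hδ0] with t ht
    rw [smul_sub, smul_smul]
    congr 2
    field_simp
  · filter_upwards [hpos] with t ht
    rw [smul_eq_mul, pow_add]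
    field_simp

end Expansion

/-! ### From the fourth-order expansion to the stated error and the limit -/

theorem theorem1 (n d k : ℕ) (M : Set (EuclideanSpace ℝ (Fin n)))
    (hMcompact : IsCompact M) (hM : IsSubmanifold d M)
    (q : EuclideanSpace ℝ (Fin n) → ℝ) (hq_smooth : SmoothOnSubmanifold d M q)
    (hq_nonneg : ∀ y ∈ M, 0 ≤ q y)
    (W : EuclideanSpace ℝ (Fin n) → KArray n k) (hW : IsDifferentialArray d M W)
    (x : EuclideanSpace ℝ (Fin n)) (hx : x ∈ M) (hqx : 0 < q x) :
    IsExteriorDerivAt d M W x (exteriorDeriv d M W x) ∧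
    (∀ δ : ℝ, 1 / 2 < δ → δ < 1 - (d : ℝ) / (2 * ((d : ℝ) + 2)) →
      (fun t : ℝ => projDiffusionOp d M q t W x - t ^ 2 • exteriorDeriv d M W x)
        =O[𝓝[>] (0 : ℝ)]
      (fun t : ℝ => t ^ (2 + min (4 * δ - 2) (2 * (1 - δ) * ((d : ℝ) + 2))))) ∧
    Tendsto (fun t : ℝ => (1 / t ^ 2) • projDiffusionOp d M q t W x) (𝓝[>] (0 : ℝ))
      (𝓝 (exteriorDeriv d M W x)) := by
  obtain ⟨hext, hO⟩ := projDiffusionOp_sub_isBigO hMcompact hM hq_smooth hW hx hqx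
  refine ⟨hext, fun δ _ hδ => hO.trans ?_, ?_⟩
  · have hδ1 : δ < 1 := hδ.trans_le (sub_le_self _ (by positivity))
    refine IsBigO.of_bound 1 ?_
    filter_upwards [Ioc_mem_nhdsGT (zero_lt_one (α := ℝ))] with t ht
    rw [one_mul, Real.norm_of_nonneg (pow_nonneg ht.1.le 4),
      Real.norm_of_nonneg (Real.rpow_nonneg ht.1.le _), ← Real.rpow_natCast]
    -- For `t ≤ 1` it suffices that the stated exponent is at most `4`; the first entry of the
    -- minimum gives `2 + (4δ - 2) = 4δ < 4`.
    refine Real.rpow_le_rpow_of_exponent_ge ht.1 ht.2 ?_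
    have := min_le_left (4 * δ - 2) (2 * (1 - δ) * ((d : ℝ) + 2))
    push_cast
    linarith
  · rw [← tendsto_sub_nhds_zero_iff]
    have hpos : ∀ᶠ t : ℝ in 𝓝[>] 0, 0 < t := self_mem_nhdsWithin
    have h1 : (fun t : ℝ => (1 / t ^ 2) • projDiffusionOp d M q t W x - exteriorDeriv d M W x)
        =O[𝓝[>] 0] fun t => t ^ 2 := by
      refine ((isBigO_refl (fun t : ℝ => 1 / t ^ 2) _).smul hO).congr' ?_ ?_
      · filter_upwards [hpos] with t ht
        rw [smul_sub, smul_smul, one_div_mul_cancel (pow_pos ht 2).ne', one_smul]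
      · filter_upwards [hpos] with t ht
        rw [smul_eq_mul]
        field_simp
    refine h1.trans_tendsto ?_
    have : Tendsto (fun t : ℝ => t ^ 2) (𝓝 0) (𝓝 0) := by
      simpa using (continuous_pow 2).tendsto (0 : ℝ)
    exact tendsto_nhdsWithin_of_tendsto_nhds this
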